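/- Define polynomials $C_n(t,q)\in\mathbb{Z}[t,q]$ by the formal continued fraction $$\sum_{n\ge 0} C_n(t,q)z^n=\cfrac{1}{1-\cfrac{z}{1-\cfrac{tz}{1-\cfrac{qz}{1-\cfrac{tqz}{1-\cfrac{q^2z}{1-\cfrac{tq^2z}{\ddots}}}}}}},$$ in which the partial numerators are $c_1z,c_2z,\dots$ with $c_{2k-1}=q^{k-1}$ and $c_{2k}=tq^{k-1}$ for $k\ge1$. Let $\mathfrak{S}_n(\tau)$ be the set of permutations $\pi=\pi(1)\cdots\pi(n)$ of $\{1,\dots,n\}$ with no subsequence order-isomorphic to the pattern $\tau$. Let $\mathrm{des}\,\pi=\#\{1\le i<n:\pi(i)>\pi(i+1)\}$, $\mathrm{exc}\,\pi=\#\{i:\pi(i)>i\}$ and $\mathrm{inv}\,\pi=\#\{(i,j):i<j,\ \pi(i)>\pi(j)\}$. Let $\mathrm{dd}\,\pi=\#\{1\le i\le n:\pi(i-1)>\pi(i)>\pi(i+1)\}$ with the convention $\pi(0)=\pi(n+1)=0$, and let $\mathrm{dd}^*\,\pi$ be the same number with the convention $\pi(0)=\pi(n+1)=n+1$. Let $$\begin{aligned}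 (31\text{-}2)\,\pi&=\#\{(i,j): i+1<j\le n,\ \pi(i+1)<\pi(j)<\pi(i)\},\\ (2\text{-}31)\,\pi&=\#\{(i,j): j<i<n,\ \pi(i+1)<\pi(j)<\pi(i)\},\\ (2\text{-}13)\,\pi&=\#\{(i,j): j<i<n,\ \pi(i)<\pi(j)<\pi(i+1)\},\\ (13\text{-}2)\,\pi&=\#\{(i,j): i+1<j\le n,\ \pi(i)<\pi(j)<\pi(i+1)\}. \end{aligned}$$ Let $\widehat{\mathfrak{S}}_{n,k}(321)$ be the set of $\pi\in\mathfrak{S}_n(321)$ with $\mathrm{exc}\,\pi=k$ such that, whenever $i<\pi(i)$, the value $i+1$ is a nonexcedance bottom, i.e. $i+1=\pi(j)$ for some $j$ with $\pi(j)\le j$. Let $\widetilde{\mathfrak{S}}_{n,k}(\tau)$ be the set of $\pi\in\mathfrak{S}_n(\tau)$ with $\mathrm{des}\,\pi=k$ and with $\mathrm{dd}\,\pi=0$ if $\tau\in\{213,312\}$, respectively $\mathrm{dd}^*\,\pi=0$ if $\tau\in\{132,231\}$. **Theorem.** For every $n\ge1$, $$C_n(t,q)=\sum_{k=0}^{\lfloor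 (n-1)/2\rfloor}\gamma_{n,k}(q)\,t^k(1+t)^{n-1-2k},$$ where, for every $k\ge0$, $$\gamma_{n,k}(q)=\sum_{\pi\in\widehat{\mathfrak{S}}_{n,k}(321)}q^{\mathrm{inv}\,\pi-\mathrm{exc}\,\pi} =\sum_{\pi\in\widetilde{\mathfrak{S}}_{n,k}(213)}q^{(31\text{-}2)\,\pi} =\sum_{\pi\in\widetilde{\mathfrak{S}}_{n,k}(312)}q^{(2\text{-}13)\,\pi} =\sum_{\pi\in\widetilde{\mathfrak{S}}_{n,k}(132)}q^{(2\text{-}31)\,\pi} =\sum_{\pi\in\widetilde{\mathfrak{S}}_{n,k}(231)}q^{(13\text{-}2)\,\pi}.$$ -/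

import Mathlib

open Polynomial

namespace QTCatalan

/-! ### Formal Stieltjes continued fractions and the `(q,t)`-Catalan numbers -/

section ContinuedFraction

variable {R : Type*} [CommRing R]

/-- The `N`-th convergent
`1 / (1 - c₀ z / (1 - c₁ z / ( ⋯ / (1 - c_{N-1} z))))`, a formal power series in `z`.
Each denominator has constant coefficient `1`, so `PowerSeries.invOfUnit _ 1` is its inverse. -/
noncomputable def convergent : (ℕ → R) → ℕ → PowerSeries R
  | _, 0 => 1
  | c, N + 1 =>
      PowerSeries.invOfUnit
        (1 - PowerSeries.C (c 0) * PowerSeries.X * convergent (fun i => c (i + 1)) N) 1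

theorem denom_mul_convergent (c : ℕ → R) (N : ℕ) :
    (1 - PowerSeries.C (c 0) * PowerSeries.X * convergent (fun i => c (i + 1)) N)
      * convergent c (N + 1) = 1 := by
  rw [convergent]
  apply PowerSeries.mul_invOfUnit
  simp

/-- The infinite continued fraction `1 / (1 - c₀ z / (1 - c₁ z / (1 - c₂ z / ⋯)))`: the
coefficientwise limit of its convergents.  By `coeff_convergent` the coefficient of `zⁿ` is the
same in all convergents from the `n`-th one on. -/
noncomputable def stieltjesFraction (c : ℕ → R) : PowerSeries R :=
  PowerSeries.mk fun n => PowerSeries.coeff n (convergent c n)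

/-- The coefficient of `zⁿ` in the convergents is constant from the `n`-th convergent on. -/
theorem coeff_convergent (c : ℕ → R) {n N : ℕ} (h : n ≤ N) :
    PowerSeries.coeff n (convergent c N) = PowerSeries.coeff n (stieltjesFraction c) := by
  have key : ∀ (M : ℕ) (c : ℕ → R),
      PowerSeries.X ^ (M + 1) ∣ convergent c (M + 1) - convergent c M := by
    intro M
    induction M with
    | zero =>
      intro c
      have h1 := denom_mul_convergent c 0
      refine ⟨PowerSeries.C (c 0) * convergent c 1, ?_⟩
      simp only [convergent] at h1 ⊢
      linear_combination h1
    | succ M ih =>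
      intro c
      have h1 := denom_mul_convergent c (M + 1)
      have h2 := denom_mul_convergent c M
      obtain ⟨d, hd⟩ := ih fun i => c (i + 1)
      refine ⟨PowerSeries.C (c 0) * d * convergent c (M + 1 + 1) * convergent c (M + 1), ?_⟩
      linear_combination
        (PowerSeries.C (c 0) * PowerSeries.X * convergent c (M + 1 + 1) * convergent c (M + 1)) * hd
          - convergent c (M + 1 + 1) * h2 + convergent c (M + 1) * h1
  rw [stieltjesFraction, PowerSeries.coeff_mk]
  induction N, h using Nat.le_induction with
  | base => rfl
  | succ M hM ih =>
    rw [← ih, ← sub_eq_zero, ← map_sub]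
    exact PowerSeries.X_pow_dvd_iff.1 (key M c) n (by omega)

end ContinuedFraction

/-- The partial numerators `1, t, q, t q, q², t q², …` (as multiples of `z`), in the ring
`ℤ[q][t]`: `t` is the outer variable `X`, and `q` is the constant `C X`. -/
noncomputable def qtCoeff (j : ℕ) : ℤ[X][X] :=
  if Even j then C X ^ (j / 2) else X * C X ^ (j / 2)

/-- The `(q,t)`-Catalan number `C_n(t,q)`, an element of `ℤ[q][t]`: the coefficient of `zⁿ` in
`1 / (1 - z / (1 - t z / (1 - q z / (1 - t q z / (1 - q² z / (1 - t q² z / ⋯))))))`. -/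
noncomputable def qtCatalan (n : ℕ) : ℤ[X][X] :=
  PowerSeries.coeff n (stieltjesFraction qtCoeff)

/-! ### Permutations, patterns and statistics -/

variable {n : ℕ}

/-- `π` avoids the pattern `p` (given by its one-line notation, such as `![2, 1, 3]`): no
subsequence of `π(1) ⋯ π(n)` is order-isomorphic to `p`. -/
def Avoids {m : ℕ} (π : Equiv.Perm (Fin n)) (p : Fin m → ℕ) : Prop :=
  ¬ ∃ f : Fin m → Fin n, StrictMono f ∧ ∀ a b, π (f a) < π (f b) ↔ p a < p b

/-- The number of inversions. -/
def inv (π : Equiv.Perm (Fin n)) : ℕ :=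
  ((Finset.univ : Finset (Fin n × Fin n)).filter fun x => x.1 < x.2 ∧ π x.2 < π x.1).card

/-- The number of excedances `i < π(i)`. -/
def exc (π : Equiv.Perm (Fin n)) : ℕ :=
  ((Finset.univ : Finset (Fin n)).filter fun i => i < π i).card

/-- `inv π - exc π` is a genuine difference of natural numbers. -/
theorem exc_le_inv (π : Equiv.Perm (Fin n)) : exc π ≤ inv π := by
  have h : ∀ i : Fin n, i < π i → ∃ j, i < j ∧ π j < π i := by
    intro i hi
    by_contra! hc
    have hsub : (Finset.Ici i).map π.toEmbedding ⊆ Finset.Ici (π i) := by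
      intro x hx
      obtain ⟨j, hj, rfl⟩ := Finset.mem_map.1 hx
      rw [Finset.mem_Ici] at hj ⊢
      rcases hj.eq_or_lt with rfl | hj
      · exact le_rfl
      · exact hc j hj
    have := Finset.card_le_card hsub
    rw [Finset.card_map, Fin.card_Ici, Fin.card_Ici] at this
    have h1 : (i : ℕ) < π i := hi
    have h2 := (π i).isLt
    omega
  classical
  choose! g hg using h
  refine Finset.card_le_card_of_injOn (fun i => (i, g i)) ?_ ?_
  · intro i hi
    have hi' : i < π i := by simpa using hi
    simpa using hg i hi'
  · intro i _ j _ hij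
    exact congrArg Prod.fst hij

/-- `v` is a nonexcedance bottom: `v = π(j)` for some `j` with `π(j) ≤ j`. -/
def IsNonexcedanceBottom (π : Equiv.Perm (Fin n)) (v : Fin n) : Prop :=
  ∃ j, π j = v ∧ π j ≤ j

/-- The one-line notation with letters and positions numbered `1, …, n`: `word b π i = π(i)` for
`1 ≤ i ≤ n`, extended by `π(i) = b` for all other `i`. -/
def word (b : ℕ) (π : Equiv.Perm (Fin n)) (i : ℕ) : ℕ :=
  if h : 1 ≤ i ∧ i ≤ n then (π ⟨i - 1, by omega⟩ : ℕ) + 1 else b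

/-- The number of descents, with the convention `π(n+1) = n+1`. -/
def des (π : Equiv.Perm (Fin n)) : ℕ :=
  ((Finset.Icc 1 n).filter fun i => word (n + 1) π i > word (n + 1) π (i + 1)).card

/-- The number of double descents `π(i-1) > π(i) > π(i+1)`, `1 ≤ i ≤ n`, with the convention
`π(0) = π(n+1) = b`. -/
def doubleDescents (b : ℕ) (π : Equiv.Perm (Fin n)) : ℕ :=
  ((Finset.Icc 1 n).filter fun i =>
    word b π (i - 1) > word b π i ∧ word b π i > word b π (i + 1)).card

/-- Double descents with the convention `π(0) = π(n+1) = 0`. -/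
def dd (π : Equiv.Perm (Fin n)) : ℕ := doubleDescents 0 π

/-- Double descents with the convention `π(0) = π(n+1) = n+1`. -/
def ddStar (π : Equiv.Perm (Fin n)) : ℕ := doubleDescents (n + 1) π

/-- Occurrences of the vincular pattern `31-2`. (Here and in the next three definitions only
positions `1, …, n` occur, so that the value `0` outside does not matter.) -/
def vinc31_2 (π : Equiv.Perm (Fin n)) : ℕ :=
  ((Finset.Icc 1 n ×ˢ Finset.Icc 1 n).filter fun x =>
    x.1 + 1 < x.2 ∧ word 0 π (x.1 + 1) < word 0 π x.2 ∧ word 0 π x.2 < word 0 π x.1).card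

/-- Occurrences of the vincular pattern `2-31`. -/
def vinc2_31 (π : Equiv.Perm (Fin n)) : ℕ :=
  ((Finset.Icc 1 n ×ˢ Finset.Icc 1 n).filter fun x =>
    x.2 < x.1 ∧ x.1 < n ∧
      word 0 π (x.1 + 1) < word 0 π x.2 ∧ word 0 π x.2 < word 0 π x.1).card

/-- Occurrences of the vincular pattern `2-13`. -/
def vinc2_13 (π : Equiv.Perm (Fin n)) : ℕ :=
  ((Finset.Icc 1 n ×ˢ Finset.Icc 1 n).filter fun x =>
    x.2 < x.1 ∧ x.1 < n ∧
      word 0 π x.1 < word 0 π x.2 ∧ word 0 π x.2 < word 0 π (x.1 + 1)).card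

/-- Occurrences of the vincular pattern `13-2`. -/
def vinc13_2 (π : Equiv.Perm (Fin n)) : ℕ :=
  ((Finset.Icc 1 n ×ˢ Finset.Icc 1 n).filter fun x =>
    x.1 + 1 < x.2 ∧ word 0 π x.1 < word 0 π x.2 ∧ word 0 π x.2 < word 0 π (x.1 + 1)).card

open Classical in
/-- The `321`-avoiding permutations with `k` excedances such that whenever `i < π(i)`, the value
`i + 1` is a nonexcedance bottom. -/
noncomputable def hatS321 (n k : ℕ) : Finset (Equiv.Perm (Fin n)) :=
  Finset.univ.filter fun π => Avoids π ![3, 2, 1] ∧ exc π = k ∧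
    ∀ i v : Fin n, i < π i → (v : ℕ) = i + 1 → IsNonexcedanceBottom π v

open Classical in
/-- The permutations avoiding `p` with `dd = 0` and `k` descents. -/
noncomputable def tildeS (p : Fin 3 → ℕ) (n k : ℕ) : Finset (Equiv.Perm (Fin n)) :=
  Finset.univ.filter fun π => Avoids π p ∧ dd π = 0 ∧ des π = k

open Classical in
/-- The permutations avoiding `p` with `dd* = 0` and `k` descents. -/
noncomputable def tildeStarS (p : Fin 3 → ℕ) (n k : ℕ) : Finset (Equiv.Perm (Fin n)) :=
  Finset.univ.filter fun π => Avoids π p ∧ ddStar π = 0 ∧ des π = k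

end QTCatalan

/-! All six quantities are governed by one first-return recurrence for weighted Motzkin paths,
`IsMotzkinSeq s t q`, which has a unique solution. As a functional equation for `G(z) = ∑ g m z ^ m`
it reads `G(z) (1 - s z - t q z² G(q z)) = 1`.

Contracting the continued fraction (writing it as `1 + z G(z)` and using that removing two levels
multiplies the numerators by `q`) shows that `C_{m+1}(t,q)` solves it with `s = 1 + t`. If `g`
solves it with `s = 1`, then `(1 + t) ^ m * g m` with `t` replaced by `t / (1 + t) ^ 2` solves it
with `s = 1 + t` (`IsMotzkinSeq.gamma_sum`). Uniqueness gives the expansion, with `γ_{m+1,k}` the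
coefficient of `t ^ k` in `g m`. It remains to show that each permutation sum produces the solution
for `s = 1`.

For `213` and `312`, cut the word at the letter `1`. Avoidance makes the left block lie entirely
above, respectively below, the right block, both blocks again being arbitrary avoiders. The letter
`1` acts for both blocks like the boundary `0`, so double descents split. An empty left block gives
the level-step term, an empty right block alone is forbidden by `dd = 0`, and two nonempty blocks
give one new descent and as many new vincular patterns as one of the blocks has letters
(`isMotzkinSeq_avoidSum`). Reverse-complement carries these two cases to `132` and `231`.

For `321`, an avoider is determined by its excedance positions and excedance values, being
increasing on the excedances and on the rest. Read positions as up steps and values, shifted by one,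
as down steps. The condition on `i + 1` says that no step is both, so the result is a Motzkin path,
and `inv - exc` is the sum of its heights (`IsHat.heightSum_stepWord`). These paths are counted step
by step by `pathSum`, and `IsMotzkinSeq.pathSum_zero` identifies that count with the first-return
recurrence. -/

namespace QTCatalan

/-! ### The Motzkin recurrence and its functional equation -/

section MotzkinSequences

variable {R : Type*} [CommRing R]

/-- `g m` is the generating polynomial of Motzkin paths of length `m` in which a level step at
height `h` has weight `s q ^ h` and a pair of steps between heights `h` and `h + 1` has weight
`t q ^ (2 h + 1)`, in terms of its first-return recurrence. -/
structure IsMotzkinSeq (s t q : R) (g : ℕ → R) : Prop where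
  zero : g 0 = 1
  one : g 1 = s
  add_two : ∀ m, g (m + 2) =
    s * g (m + 1) + t * q * ∑ x ∈ Finset.HasAntidiagonal.antidiagonal m, q ^ x.2 * (g x.1 * g x.2)

theorem IsMotzkinSeq.unique {s t q : R} {f g : ℕ → R} (hf : IsMotzkinSeq s t q f)
    (hg : IsMotzkinSeq s t q g) : f = g := by
  funext m
  induction m using Nat.strong_induction_on with
  | _ m ih =>
    match m, ih with
    | 0, _ => rw [hf.zero, hg.zero]
    | 1, _ => rw [hf.one, hg.one]
    | m + 2, ih =>
      rw [hf.add_two, hg.add_two, ih (m + 1) (by omega)]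
      congr 2
      refine Finset.sum_congr rfl fun x hx => ?_
      have := Finset.HasAntidiagonal.mem_antidiagonal.1 hx
      rw [ih x.1 (by omega), ih x.2 (by omega)]

/-- Raising a path of length `x.2` by one level multiplies its weight by `q ^ x.2`, which is the
substitution `z ↦ q z`. The proof compares the coefficients of degrees `0`, `1` and `m + 2`. -/
theorem isMotzkinSeq_iff {s t q : R} {g : ℕ → R} :
    IsMotzkinSeq s t q g ↔
      PowerSeries.mk g * (1 - PowerSeries.C s * PowerSeries.X -
        PowerSeries.C (t * q) * PowerSeries.X ^ 2 *
          PowerSeries.rescale q (PowerSeries.mk g)) = 1 := by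
  have e : PowerSeries.mk g * (1 - PowerSeries.C s * PowerSeries.X -
        PowerSeries.C (t * q) * PowerSeries.X ^ 2 * PowerSeries.rescale q (PowerSeries.mk g)) =
      PowerSeries.mk g - PowerSeries.C s * (PowerSeries.mk g * PowerSeries.X) -
        PowerSeries.C (t * q) * ((PowerSeries.mk g *
          PowerSeries.rescale q (PowerSeries.mk g)) * PowerSeries.X ^ 2) := by ring
  rw [e]
  have c0 : PowerSeries.coeff 0 (PowerSeries.mk g - PowerSeries.C s * (PowerSeries.mk g *
      PowerSeries.X) - PowerSeries.C (t * q) * ((PowerSeries.mk g *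
        PowerSeries.rescale q (PowerSeries.mk g)) * PowerSeries.X ^ 2)) = g 0 := by
    simp
  have c1 : PowerSeries.coeff 1 (PowerSeries.mk g - PowerSeries.C s * (PowerSeries.mk g *
      PowerSeries.X) - PowerSeries.C (t * q) * ((PowerSeries.mk g *
        PowerSeries.rescale q (PowerSeries.mk g)) * PowerSeries.X ^ 2)) = g 1 - s * g 0 := by
    rw [map_sub, map_sub, PowerSeries.coeff_C_mul, PowerSeries.coeff_C_mul,
      PowerSeries.coeff_mul_X_pow', show (1 : ℕ) = 0 + 1 from rfl,
      PowerSeries.coeff_succ_mul_X]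
    simp
  have c2 : ∀ m, PowerSeries.coeff (m + 2) (PowerSeries.mk g - PowerSeries.C s *
      (PowerSeries.mk g * PowerSeries.X) - PowerSeries.C (t * q) * ((PowerSeries.mk g *
        PowerSeries.rescale q (PowerSeries.mk g)) * PowerSeries.X ^ 2)) =
      g (m + 2) - s * g (m + 1) -
        t * q * ∑ x ∈ Finset.HasAntidiagonal.antidiagonal m, q ^ x.2 * (g x.1 * g x.2) := by
    intro m
    rw [map_sub, map_sub, PowerSeries.coeff_C_mul, PowerSeries.coeff_C_mul,
      PowerSeries.coeff_mul_X_pow, show m + 2 = (m + 1) + 1 from rfl,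
      PowerSeries.coeff_succ_mul_X, PowerSeries.coeff_mul]
    simp only [PowerSeries.coeff_mk, PowerSeries.coeff_rescale]
    congr 2
    exact Finset.sum_congr rfl fun x _ => by ring
  constructor
  · intro h
    ext m
    match m with
    | 0 => rw [c0, h.zero]; simp
    | 1 => rw [c1, h.zero, h.one]; simp [PowerSeries.coeff_one]
    | m + 2 => rw [c2, h.add_two]; simp [PowerSeries.coeff_one]
  · intro h
    rw [h] at c0 c1 c2
    have h0 : g 0 = 1 := by rw [← c0]; simp
    refine ⟨h0, ?_, fun m => ?_⟩
    · rw [h0] at c1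
      simp only [PowerSeries.coeff_one] at c1
      simp only [one_ne_zero, if_false] at c1
      linear_combination -c1
    · have := c2 m
      simp only [PowerSeries.coeff_one] at this
      simp only [Nat.add_eq_zero_iff, OfNat.ofNat_ne_zero, and_false, if_false] at this
      linear_combination -this

end MotzkinSequences

/-! ### Contraction of the continued fraction -/

section StieltjesFraction

variable {R : Type*} [CommRing R]

/-- The coefficient of `z ^ n` in the product involves only coefficients of degree at most `n`,
where the fractions agree with their convergents. -/
theorem denom_mul_stieltjesFraction (c : ℕ → R) :
    (1 - PowerSeries.C (c 0) * PowerSeries.X * stieltjesFraction (fun i => c (i + 1)))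
      * stieltjesFraction c = 1 := by
  ext n
  refine Eq.trans ?_ (congrArg (PowerSeries.coeff n) (denom_mul_convergent c n))
  rw [PowerSeries.coeff_mul, PowerSeries.coeff_mul]
  refine Finset.sum_congr rfl fun x hx => ?_
  have hx := Finset.HasAntidiagonal.mem_antidiagonal.1 hx
  rw [coeff_convergent c (show x.2 ≤ n + 1 by omega)]
  congr 1
  rw [map_sub, map_sub, mul_assoc, mul_assoc, PowerSeries.coeff_C_mul, PowerSeries.coeff_C_mul]
  obtain ⟨_ | i, j⟩ := x
  · simp
  · rw [PowerSeries.coeff_succ_X_mul, PowerSeries.coeff_succ_X_mul, coeff_convergent _ (show i ≤ n by simp at hx; omega)]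

theorem rescale_C (a r : R) : PowerSeries.rescale a (PowerSeries.C r) = PowerSeries.C r := by
  ext n
  rw [PowerSeries.coeff_rescale, PowerSeries.coeff_C]
  split_ifs with h <;> simp [h]

theorem rescale_convergent (q : R) (c : ℕ → R) (N : ℕ) :
    PowerSeries.rescale q (convergent c N) = convergent (fun i => q * c i) N := by
  induction N generalizing c with
  | zero => simp [convergent]
  | succ N ih =>
    have h1 := congrArg (PowerSeries.rescale q) (denom_mul_convergent c N)
    have h2 := denom_mul_convergent (fun i => q * c i) N
    rw [map_mul, map_sub, map_mul, map_mul, map_one, ih, PowerSeries.rescale_X, rescale_C] at h1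
    rw [map_mul] at h2
    linear_combination (convergent (fun i => q * c i) (N + 1)) * h1 -
      PowerSeries.rescale q (convergent c (N + 1)) * h2

theorem rescale_stieltjesFraction (q : R) (c : ℕ → R) :
    PowerSeries.rescale q (stieltjesFraction c) = stieltjesFraction (fun i => q * c i) := by
  ext n
  rw [PowerSeries.coeff_rescale, ← coeff_convergent c le_rfl, ← PowerSeries.coeff_rescale,
    rescale_convergent, coeff_convergent _ le_rfl]

/-- The contraction of the fraction with partial numerators `1, t, q, t q, q², …`. -/
theorem isMotzkinSeq_coeff_stieltjesFraction (t q : R) (c : ℕ → R) (h0 : c 0 = 1) (h1 : c 1 = t)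
    (hc : ∀ i, c (i + 2) = q * c i) :
    IsMotzkinSeq (1 + t) t q
      fun m => PowerSeries.coeff (m + 1) (stieltjesFraction c) := by
  rw [isMotzkinSeq_iff]
  set G : PowerSeries R :=
    PowerSeries.mk fun m => PowerSeries.coeff (m + 1) (stieltjesFraction c) with hG
  have e1 := denom_mul_stieltjesFraction c
  have e2 := denom_mul_stieltjesFraction fun i => c (i + 1)
  have e3 : (fun i => c (i + 1 + 1)) = fun i => q * c i := funext hc
  simp only [e3, ← rescale_stieltjesFraction, zero_add, h1] at e2
  rw [h0, map_one, one_mul] at e1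
  have e4 : stieltjesFraction c = 1 + PowerSeries.X * G := by
    ext n
    cases n with
    | zero =>
      rw [← coeff_convergent c le_rfl]
      simp [convergent]
    | succ n => simp [hG, PowerSeries.coeff_succ_X_mul, PowerSeries.coeff_one]
  have e5 : PowerSeries.rescale q (stieltjesFraction c) =
      1 + PowerSeries.C q * PowerSeries.X * PowerSeries.rescale q G := by
    rw [e4, map_add, map_mul, map_one, PowerSeries.rescale_X]
  rw [e5] at e2
  set D := stieltjesFraction fun i => c (i + 1)
  set S := stieltjesFraction c
  -- With `S = 1 + z G`, the relation `(1 - z D) S = 1` becomes `z G = z D S`; cancel `z`. Since `D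
  -- (1 - t z S(q z)) = 1`, the inverse of `G` is then `(1 - z D) (1 - t z S(q z)) = 1 - z - t z S(q
  -- z)`.
  have e6 : G = D * S := by
    have : PowerSeries.X * (G - D * S) = 0 := by linear_combination e1 - e4
    have := congrArg (fun f => PowerSeries.mk fun n => PowerSeries.coeff (n + 1) f) this
    simp only [PowerSeries.coeff_succ_X_mul, map_zero] at this
    ext n
    have := congrArg (PowerSeries.coeff n) this
    simpa [sub_eq_zero] using this
  rw [map_mul, map_add, map_one]
  set H := PowerSeries.rescale q G
  linear_combination (1 - PowerSeries.X - PowerSeries.C t * PowerSeries.X -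
    PowerSeries.C t * PowerSeries.C q * PowerSeries.X ^ 2 * H) * e6 + S * e2 + e1

end StieltjesFraction

theorem isMotzkinSeq_qtCatalan :
    IsMotzkinSeq (1 + X) X (C X) fun m => qtCatalan (m + 1) := by
  refine isMotzkinSeq_coeff_stieltjesFraction X (C X) qtCoeff ?_ ?_ fun i => ?_
  · simp [qtCoeff]
  · simp [qtCoeff]
  · have h : Even (i + 2) ↔ Even i := by simp [Nat.even_add]
    simp only [qtCoeff, h, show (i + 2) / 2 = i / 2 + 1 by omega]
    split_ifs <;> ring

/-! ### The gamma expansion -/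

section GammaExpansion

/-- `t ↦ t / (1 + t)²`, followed by the inclusion in the fraction field. -/
noncomputable def gammaSubst : ℤ[X][X] →+* FractionRing ℤ[X][X] :=
  eval₂RingHom ((algebraMap ℤ[X][X] (FractionRing ℤ[X][X])).comp C)
    (algebraMap ℤ[X][X] (FractionRing ℤ[X][X]) X /
      (algebraMap ℤ[X][X] (FractionRing ℤ[X][X]) (1 + X)) ^ 2)

theorem algebraMap_one_add_X_ne_zero :
    algebraMap ℤ[X][X] (FractionRing ℤ[X][X]) (1 + X) ≠ 0 := by
  rw [Ne, FaithfulSMul.algebraMap_eq_zero_iff]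
  intro h
  simpa [coeff_one] using congrArg (fun p => coeff p 1) h

/-- Termwise, `t ^ k (1 + t) ^ (m - 2 k) = (1 + t) ^ m (t / (1 + t) ²) ^ k`. The degree bound
ensures that the truncated sum sees every coefficient of `p`. -/
theorem algebraMap_gamma_sum {m : ℕ} {p : ℤ[X][X]} (hp : 2 * p.natDegree ≤ m) :
    algebraMap ℤ[X][X] (FractionRing ℤ[X][X])
        (∑ k ∈ Finset.range (m / 2 + 1), C (p.coeff k) * X ^ k * (1 + X) ^ (m - 2 * k)) =
      algebraMap ℤ[X][X] (FractionRing ℤ[X][X]) (1 + X) ^ m * gammaSubst p := by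
  have h0 := algebraMap_one_add_X_ne_zero
  rw [gammaSubst, coe_eval₂RingHom, eval₂_eq_sum_range' _ (show p.natDegree < m / 2 + 1 by omega),
    map_sum, Finset.mul_sum]
  refine Finset.sum_congr rfl fun k hk => ?_
  have hk := Finset.mem_range.1 hk
  obtain ⟨j, rfl⟩ := Nat.exists_eq_add_of_le (show 2 * k ≤ m by omega)
  rw [show 2 * k + j - 2 * k = j by omega, map_mul, map_mul, map_pow, map_pow,
    RingHom.comp_apply, div_pow, pow_add, ← pow_mul]
  field_simp

variable {g : ℕ → ℤ[X][X]}

/-- Each factor `t` is paid for by a pair of steps. -/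
theorem IsMotzkinSeq.two_mul_natDegree_le (hg : IsMotzkinSeq 1 X (C X) g) (m : ℕ) :
    2 * (g m).natDegree ≤ m := by
  induction m using Nat.strong_induction_on with
  | _ m ih =>
    match m, ih with
    | 0, _ => simp [hg.zero]
    | 1, _ => simp [hg.one]
    | m + 2, ih =>
      rw [hg.add_two]
      have h1 := ih (m + 1) (by omega)
      have h2 : (∑ x ∈ Finset.HasAntidiagonal.antidiagonal m, (C X : ℤ[X][X]) ^ x.2 * (g x.1 * g x.2)).natDegree
          ≤ m / 2 := by
        refine natDegree_sum_le_of_forall_le _ _ fun x hx => ?_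
        have hx := Finset.HasAntidiagonal.mem_antidiagonal.1 hx
        have i1 := ih x.1 (by omega)
        have i2 := ih x.2 (by omega)
        rw [← C_pow]
        refine (natDegree_C_mul_le _ _).trans (natDegree_mul_le.trans ?_)
        omega
      have h3 : ((X : ℤ[X][X]) * C X *
          ∑ x ∈ Finset.HasAntidiagonal.antidiagonal m, (C X : ℤ[X][X]) ^ x.2 * (g x.1 * g x.2)).natDegree
          ≤ m / 2 + 1 := by
        refine natDegree_mul_le.trans ?_
        have : ((X : ℤ[X][X]) * C X).natDegree ≤ 1 := natDegree_mul_le.trans (by simp)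
        omega
      rw [one_mul]
      have := natDegree_add_le_of_degree_le (n := (m + 2) / 2) (p := g (m + 1))
        (by omega) (h3.trans (by omega))
      omega

theorem IsMotzkinSeq.gamma_sum (hg : IsMotzkinSeq 1 X (C X) g) :
    IsMotzkinSeq (R := ℤ[X][X]) (1 + X) X (C X) fun m =>
      ∑ k ∈ Finset.range (m / 2 + 1), C ((g m).coeff k) * X ^ k * (1 + X) ^ (m - 2 * k) := by
  refine ⟨by simp [hg.zero], by simp [hg.one], fun m => ?_⟩
  have h0 := algebraMap_one_add_X_ne_zero
  apply FaithfulSMul.algebraMap_injective ℤ[X][X] (FractionRing ℤ[X][X])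
  -- The shapes are spelled out so that the map is pushed only as far as the gamma sums, which must
  -- stay intact for `algebraMap_gamma_sum`.
  simp only [map_add _ (_ * _) (_ * _), map_mul _ _ (∑ _ ∈ Finset.range _, _),
    map_mul _ _ (∑ _ ∈ Finset.HasAntidiagonal.antidiagonal _, _)]
  rw [map_sum _ _ (Finset.HasAntidiagonal.antidiagonal m)]
  simp only [map_mul _ _ (_ * _), map_mul _ (∑ _ ∈ _, _) (∑ _ ∈ _, _)]
  simp only [algebraMap_gamma_sum (hg.two_mul_natDegree_le _)]
  have hX : gammaSubst X = algebraMap ℤ[X][X] (FractionRing ℤ[X][X]) X /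
      (algebraMap ℤ[X][X] (FractionRing ℤ[X][X]) (1 + X)) ^ 2 := by
    simp [gammaSubst]
  have hq : gammaSubst (C X) = algebraMap ℤ[X][X] (FractionRing ℤ[X][X]) (C X) := by
    simp [gammaSubst]
  rw [hg.add_two]
  simp only [map_add, map_mul, map_pow, map_sum, map_one] at h0 hX ⊢
  rw [hX, hq, one_mul, mul_add]
  congr 1
  · ring
  -- Here `(1 + t) ^ (m + 2)` times `t / (1 + t) ^ 2` leaves `t (1 + t) ^ m`, and the power splits
  -- between the two factors because `x.1 + x.2 = m`.
  · rw [Finset.mul_sum, Finset.mul_sum, Finset.mul_sum]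
    refine Finset.sum_congr rfl fun x hx => ?_
    rw [← Finset.HasAntidiagonal.mem_antidiagonal.1 hx]
    field_simp
    ring

theorem qtCatalan_eq_gamma_sum (hg : IsMotzkinSeq 1 X (C X) g) (m : ℕ) :
    qtCatalan (m + 1) =
      ∑ k ∈ Finset.range (m / 2 + 1), C ((g m).coeff k) * X ^ k * (1 + X) ^ (m - 2 * k) :=
  congrFun (isMotzkinSeq_qtCatalan.unique hg.gamma_sum) m

end GammaExpansion

/-! ### From first returns to single steps -/

section Transfer

variable {R : Type*} [CommRing R]

/-- The generating polynomial of Motzkin paths of length `m` from height `h` to height `0`, in which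
each step has the weight `q ^ j`, where `j` is the height after the step, and each up step has the
additional weight `t`. -/
def pathSum (t q : R) : ℕ → ℕ → R
  | 0, h => if h = 0 then 1 else 0
  | m + 1, h => q ^ h * pathSum t q m h + t * q ^ (h + 1) * pathSum t q m (h + 1) +
      if h = 0 then 0 else q ^ (h - 1) * pathSum t q m (h - 1)

/-- The generating function of paths from height `h` to height `0`, decomposed at the last visits of
the heights `h, h - 1, …, 1`. -/
noncomputable def pathSeries (q : R) (Γ : PowerSeries R) : ℕ → PowerSeries R
  | 0 => Γ
  | h + 1 => PowerSeries.C (q ^ h) * PowerSeries.X * PowerSeries.rescale (q ^ (h + 1)) Γ *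
      pathSeries q Γ h

variable {t q : R} {g : ℕ → R}

/-- This is the first-step recursion of `pathSum` for generating functions. It is the functional
equation at `q ^ h z`, multiplied for `h > 0` by the remaining factors of `pathSeries`. A rise from
`h` and its matching fall weigh `t q ^ (h + 1) * q ^ h`, as required. -/
theorem IsMotzkinSeq.pathSeries_eq (hg : IsMotzkinSeq 1 t q g) (h : ℕ) :
    pathSeries q (PowerSeries.mk g) h =
      (if h = 0 then 1 else
        PowerSeries.C (q ^ (h - 1)) * (PowerSeries.X * pathSeries q (PowerSeries.mk g) (h - 1))) +
      PowerSeries.C (q ^ h) * (PowerSeries.X * pathSeries q (PowerSeries.mk g) h) +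
      PowerSeries.C (t * q ^ (h + 1)) *
        (PowerSeries.X * pathSeries q (PowerSeries.mk g) (h + 1)) := by
  have key := congrArg (PowerSeries.rescale (q ^ h)) (isMotzkinSeq_iff.1 hg)
  simp only [map_mul, map_sub, map_one, map_pow, PowerSeries.rescale_X, rescale_C,
    PowerSeries.rescale_rescale, ← pow_succ'] at key
  simp only [one_mul] at key
  cases h with
  | zero =>
    simp only [pathSeries, if_true]
    simp only [pow_zero, PowerSeries.rescale_one, RingHom.id_apply, zero_add, pow_one, map_mul,
      map_one] at key ⊢
    linear_combination key
  | succ h =>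
    simp only [pathSeries, Nat.add_eq_zero_iff, one_ne_zero, and_false, if_false,
      Nat.add_sub_cancel, map_mul, map_pow] at key ⊢
    linear_combination PowerSeries.C q ^ h * PowerSeries.X *
      pathSeries q (PowerSeries.mk g) h * key

theorem IsMotzkinSeq.coeff_pathSeries (hg : IsMotzkinSeq 1 t q g) (m h : ℕ) :
    PowerSeries.coeff m (pathSeries q (PowerSeries.mk g) h) = pathSum t q m h := by
  induction m generalizing h with
  | zero =>
    rw [hg.pathSeries_eq, pathSum]
    split_ifs <;> simp
  | succ m ih =>
    rw [hg.pathSeries_eq, map_add, map_add, PowerSeries.coeff_C_mul, PowerSeries.coeff_C_mul,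
      PowerSeries.coeff_succ_X_mul, PowerSeries.coeff_succ_X_mul, ih, ih, pathSum]
    split_ifs with h0
    · simp [PowerSeries.coeff_one]
    · rw [PowerSeries.coeff_C_mul, PowerSeries.coeff_succ_X_mul, ih]
      ring

theorem IsMotzkinSeq.pathSum_zero (hg : IsMotzkinSeq 1 t q g) (m : ℕ) :
    pathSum t q m 0 = g m := by
  rw [← hg.coeff_pathSeries, pathSeries, PowerSeries.coeff_mk]

end Transfer

/-! ### One-line notation and pattern avoidance -/

section Word

variable {n : ℕ}

theorem word_of_mem (b : ℕ) (π : Equiv.Perm (Fin n)) {i : ℕ} (h : i < n) :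
    word b π (i + 1) = π ⟨i, h⟩ + 1 := by
  rw [word, dif_pos ⟨by omega, by omega⟩]
  rfl

theorem word_of_not_mem (b : ℕ) (π : Equiv.Perm (Fin n)) {i : ℕ} (h : ¬(1 ≤ i ∧ i ≤ n)) :
    word b π i = b := dif_neg h

theorem one_le_word (b : ℕ) (π : Equiv.Perm (Fin n)) {i : ℕ} (h : 1 ≤ i) (h' : i ≤ n) :
    1 ≤ word b π i := by
  rw [word, dif_pos ⟨h, h'⟩]; omega

theorem word_le (b : ℕ) (π : Equiv.Perm (Fin n)) {i : ℕ} (h : 1 ≤ i) (h' : i ≤ n) :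
    word b π i ≤ n := by
  rw [word, dif_pos ⟨h, h'⟩]; omega

theorem word_zero_le (π : Equiv.Perm (Fin n)) (i : ℕ) : word 0 π i ≤ n := by
  by_cases h : 1 ≤ i ∧ i ≤ n
  · exact word_le 0 π h.1 h.2
  · rw [word_of_not_mem 0 π h]; omega

theorem word_zero_pos_iff (π : Equiv.Perm (Fin n)) (i : ℕ) :
    0 < word 0 π i ↔ 1 ≤ i ∧ i ≤ n := by
  constructor
  · intro h
    by_contra hc
    rw [word_of_not_mem 0 π hc] at h
    omega
  · rintro ⟨h, h'⟩
    exact one_le_word 0 π h h'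

theorem word_inj (b : ℕ) (π : Equiv.Perm (Fin n)) {i j : ℕ} (hi : 1 ≤ i) (hi' : i ≤ n)
    (hj : 1 ≤ j) (hj' : j ≤ n) (h : word b π i = word b π j) : i = j := by
  rw [word, word, dif_pos ⟨hi, hi'⟩, dif_pos ⟨hj, hj'⟩] at h
  have := π.injective (Fin.ext (Nat.succ_injective h))
  have := congrArg Fin.val this
  simp only at this
  omega

theorem word_congr_boundary (b b' : ℕ) (π : Equiv.Perm (Fin n)) {i : ℕ} (h : 1 ≤ i)
    (h' : i ≤ n) : word b π i = word b' π i := by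
  rw [word, word, dif_pos ⟨h, h'⟩, dif_pos ⟨h, h'⟩]

theorem eq_of_word_eq {π ρ : Equiv.Perm (Fin n)} (b : ℕ)
    (h : ∀ i, 1 ≤ i → i ≤ n → word b π i = word b ρ i) : π = ρ := by
  ext i
  have := h (i + 1) (by omega) (by omega)
  rw [word_of_mem b π i.isLt, word_of_mem b ρ i.isLt] at this
  simpa using this

/-- All six strict comparisons are kept, so that for a concrete pattern `simp` decides the
right-hand sides and `omega` discards the redundant ones. -/
theorem avoids_iff_word (π : Equiv.Perm (Fin n)) (p : Fin 3 → ℕ) (b : ℕ) :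
    Avoids π p ↔ ∀ i j k, 1 ≤ i → i < j → j < k → k ≤ n →
      ¬((word b π i < word b π j ↔ p 0 < p 1) ∧ (word b π j < word b π i ↔ p 1 < p 0) ∧
        (word b π i < word b π k ↔ p 0 < p 2) ∧ (word b π k < word b π i ↔ p 2 < p 0) ∧
        (word b π j < word b π k ↔ p 1 < p 2) ∧ (word b π k < word b π j ↔ p 2 < p 1)) := by
  constructor
  · rintro h i j k hi hij hjk hk hc
    refine h ⟨![⟨i - 1, by omega⟩, ⟨j - 1, by omega⟩, ⟨k - 1, by omega⟩], ?_, ?_⟩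
    · refine Fin.strictMono_iff_lt_succ.2 (Fin.forall_fin_two.2 ⟨?_, ?_⟩)
      · exact Fin.mk_lt_mk.2 (by omega)
      · exact Fin.mk_lt_mk.2 (by omega)
    · simp only [word, show 1 ≤ i ∧ i ≤ n by omega, show 1 ≤ j ∧ j ≤ n by omega,
        show 1 ≤ k ∧ k ≤ n by omega, and_self, dite_true, Nat.add_lt_add_iff_right,
        Fin.val_fin_lt] at hc
      obtain ⟨h1, h2, h3, h4, h5, h6⟩ := hc
      intro x y
      fin_cases x <;> fin_cases y <;>
        first
        | exact h1 | exact h2 | exact h3 | exact h4 | exact h5 | exact h6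
        | exact iff_of_false (lt_irrefl _) (lt_irrefl _)
  · rintro h ⟨f, hf, hp⟩
    have h01 : f 0 < f 1 := hf (by decide)
    have h12 : f 1 < f 2 := hf (by decide)
    refine h (f 0 + 1) (f 1 + 1) (f 2 + 1) (by omega) (by simpa using h01) (by simpa using h12)
      (by omega) ?_
    simp only [word_of_mem b π (f _).isLt, Nat.add_lt_add_iff_right, Fin.eta, Fin.val_fin_lt, hp,
      and_self]

theorem avoids_213_iff (π : Equiv.Perm (Fin n)) (b : ℕ) :
    Avoids π ![2, 1, 3] ↔ ∀ i j k, 1 ≤ i → i < j → j < k → k ≤ n →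
      word b π j < word b π i → ¬ word b π i < word b π k := by
  rw [avoids_iff_word π _ b]
  refine forall₃_congr fun i j k => forall₄_congr fun _ _ _ _ => ?_
  simp
  omega

theorem avoids_312_iff (π : Equiv.Perm (Fin n)) (b : ℕ) :
    Avoids π ![3, 1, 2] ↔ ∀ i j k, 1 ≤ i → i < j → j < k → k ≤ n →
      word b π j < word b π k → ¬ word b π k < word b π i := by
  rw [avoids_iff_word π _ b]
  refine forall₃_congr fun i j k => forall₄_congr fun _ _ _ _ => ?_
  simp
  omega

theorem avoids_132_iff (π : Equiv.Perm (Fin n)) (b : ℕ) :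
    Avoids π ![1, 3, 2] ↔ ∀ i j k, 1 ≤ i → i < j → j < k → k ≤ n →
      word b π i < word b π k → ¬ word b π k < word b π j := by
  rw [avoids_iff_word π _ b]
  refine forall₃_congr fun i j k => forall₄_congr fun _ _ _ _ => ?_
  simp
  omega

theorem avoids_231_iff (π : Equiv.Perm (Fin n)) (b : ℕ) :
    Avoids π ![2, 3, 1] ↔ ∀ i j k, 1 ≤ i → i < j → j < k → k ≤ n →
      word b π k < word b π i → ¬ word b π i < word b π j := by
  rw [avoids_iff_word π _ b]
  refine forall₃_congr fun i j k => forall₄_congr fun _ _ _ _ => ?_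
  simp
  omega

theorem avoids_321_iff (π : Equiv.Perm (Fin n)) :
    Avoids π ![3, 2, 1] ↔ ∀ i j k : Fin n, i < j → j < k → π j < π i → ¬ π k < π j := by
  constructor
  · rintro h i j k hij hjk h1 h2
    refine h ⟨![i, j, k], ?_, ?_⟩
    · exact Fin.strictMono_iff_lt_succ.2 (Fin.forall_fin_two.2 ⟨hij, hjk⟩)
    · have h3 := h2.trans h1
      intro x y
      fin_cases x <;> fin_cases y <;> simp [h1, h2, h3, h1.le, h2.le, h3.le]
  · rintro h ⟨f, hf, hp⟩
    exact h _ _ _ (hf (show (0 : Fin 3) < 1 by decide)) (hf (show (1 : Fin 3) < 2 by decide))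
      ((hp _ _).2 (by simp)) ((hp _ _).2 (by simp))

/-- Descents, including the one in front of the final `0`. -/
theorem card_descents_zero (π : Equiv.Perm (Fin n)) (hn : 1 ≤ n) :
    ((Finset.Icc 1 n).filter fun i => word 0 π i > word 0 π (i + 1)).card = des π + 1 := by
  obtain ⟨m, rfl⟩ : ∃ m, n = m + 1 := ⟨n - 1, by omega⟩
  rw [des, Finset.card_filter, Finset.card_filter, Finset.sum_Icc_succ_top (by omega),
    Finset.sum_Icc_succ_top (by omega)]
  have h1 := word_of_not_mem 0 π (show ¬(1 ≤ m + 1 + 1 ∧ m + 1 + 1 ≤ m + 1) by omega)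
  have h2 := word_of_not_mem (m + 1 + 1) π (show ¬(1 ≤ m + 1 + 1 ∧ m + 1 + 1 ≤ m + 1) by omega)
  have h3 := one_le_word 0 π (show 1 ≤ m + 1 by omega) le_rfl
  have h4 := word_le (m + 1 + 1) π (show 1 ≤ m + 1 by omega) le_rfl
  rw [if_pos (by omega), if_neg (by omega), add_zero]
  congr 1
  refine Finset.sum_congr rfl fun i hi => ?_
  have hi := Finset.mem_Icc.1 hi
  rw [word_congr_boundary 0 (m + 1 + 1) π (by omega) (by omega),
    word_congr_boundary 0 (m + 1 + 1) π (show 1 ≤ i + 1 by omega) (by omega)]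

end Word

theorem sum_Icc_add_one_add {M : Type*} [AddCommMonoid M] (l r : ℕ) (f : ℕ → M) :
    ∑ i ∈ Finset.Icc 1 (l + 1 + r), f i =
      ∑ i ∈ Finset.Icc 1 l, f i + f (l + 1) + ∑ i ∈ Finset.Icc 1 r, f (l + 1 + i) := by
  induction r with
  | zero => simp [Finset.sum_Icc_succ_top]
  | succ r ih =>
    rw [← add_assoc, Finset.sum_Icc_succ_top (by omega), ih, Finset.sum_Icc_succ_top (by omega),
      add_assoc, add_assoc (_ + _)]

theorem add_add_eq_left {a b c s : ℕ} (ha : a = s) (hb : b = 0) (hc : c = 0) : a + b + c = s := by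
  omega

theorem add_add_eq_right {a b c s : ℕ} (ha : a = 0) (hb : b = 0) (hc : c = s) : a + b + c = s := by
  omega

/-! ### Statistics of a word cut at its smallest letter -/

section Glue

variable {l r : ℕ}

/-- The word `σ' 1 τ'`, where `σ'` and `τ'` are order-isomorphic to `σ` and `τ`, and the letters of
`σ'` are all greater (`d = true`) or all smaller (`d = false`) than those of `τ'`. -/
def glueWord (d : Bool) (σ : Equiv.Perm (Fin l)) (τ : Equiv.Perm (Fin r)) (i : ℕ) : ℕ :=
  if i ≤ l then word 0 σ i + (if d then r else 0) + 1
  else if i = l + 1 then 1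
  else word 0 τ (i - (l + 1)) + (if d then 0 else l) + 1

theorem glueWord_bounds (d : Bool) (σ : Equiv.Perm (Fin l)) (τ : Equiv.Perm (Fin r)) {i : ℕ} :
    1 ≤ glueWord d σ τ i ∧ glueWord d σ τ i ≤ l + 1 + r := by
  have h1 := word_zero_le σ i
  have h2 := word_zero_le τ (i - (l + 1))
  unfold glueWord
  split_ifs <;> omega

theorem glueWord_inj (d : Bool) (σ : Equiv.Perm (Fin l)) (τ : Equiv.Perm (Fin r)) {i j : ℕ}
    (hi : 1 ≤ i) (hi' : i ≤ l + 1 + r) (hj : 1 ≤ j) (hj' : j ≤ l + 1 + r)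
    (h : glueWord d σ τ i = glueWord d σ τ j) : i = j := by
  have a1 := word_zero_le σ i
  have a2 := word_zero_le τ (i - (l + 1))
  have a3 := word_zero_le σ j
  have a4 := word_zero_le τ (j - (l + 1))
  have b1 := word_zero_pos_iff σ i
  have b2 := word_zero_pos_iff τ (i - (l + 1))
  have b3 := word_zero_pos_iff σ j
  have b4 := word_zero_pos_iff τ (j - (l + 1))
  by_cases hil : i ≤ l <;> by_cases hjl : j ≤ l
  · refine word_inj 0 σ hi hil hj hjl ?_
    simpa [glueWord, hil, hjl] using h
  · simp only [glueWord, hil, hjl, if_true, if_false] at h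
    split_ifs at h <;> omega
  · simp only [glueWord, hil, hjl, if_true, if_false] at h
    split_ifs at h <;> omega
  · simp only [glueWord, hil, hjl, if_false] at h
    by_cases hi1 : i = l + 1 <;> by_cases hj1 : j = l + 1
    · omega
    · simp only [hi1, hj1, if_true, if_false] at h; omega
    · simp only [hi1, hj1, if_true, if_false] at h; omega
    · simp only [hi1, hj1, if_false, add_left_inj] at h
      have := word_inj 0 τ (by omega) (by omega) (by omega) (by omega) h
      omega

/-- The permutation with the word `glueWord`. -/
noncomputable def glue (d : Bool) (σ : Equiv.Perm (Fin l)) (τ : Equiv.Perm (Fin r)) :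
    Equiv.Perm (Fin (l + 1 + r)) :=
  Equiv.ofBijective
    (fun i => ⟨glueWord d σ τ (i + 1) - 1, by have := glueWord_bounds d σ τ (i := i + 1); omega⟩) <|
    Finite.injective_iff_bijective.1 fun i j h => by
      have h := congrArg Fin.val h
      have b1 := glueWord_bounds d σ τ (i := i + 1)
      have b2 := glueWord_bounds d σ τ (i := j + 1)
      have := glueWord_inj d σ τ (i := i + 1) (j := j + 1) (by omega) (by omega) (by omega)
        (by omega) (by simp only at h; omega)
      exact Fin.ext (by omega)

variable (d : Bool) (σ : Equiv.Perm (Fin l)) (τ : Equiv.Perm (Fin r))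

theorem word_glue (b : ℕ) {i : ℕ} (hi : 1 ≤ i) (hi' : i ≤ l + 1 + r) :
    word b (glue d σ τ) i = glueWord d σ τ i := by
  obtain ⟨j, rfl⟩ : ∃ j, i = j + 1 := ⟨i - 1, by omega⟩
  rw [word_of_mem b _ (by omega)]
  have := glueWord_bounds d σ τ (i := j + 1)
  simp only [glue, Equiv.ofBijective_apply]
  omega

theorem word_glue_left (b : ℕ) {i : ℕ} (hi : 1 ≤ i) (hi' : i ≤ l) :
    word b (glue d σ τ) i = word 0 σ i + (if d then r else 0) + 1 := by
  rw [word_glue d σ τ b hi (by omega), glueWord, if_pos hi']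

theorem word_glue_mid (b : ℕ) : word b (glue d σ τ) (l + 1) = 1 := by
  rw [word_glue d σ τ b (by omega) (by omega), glueWord, if_neg (by omega), if_pos rfl]

theorem word_glue_right (b : ℕ) {i : ℕ} (hi : 1 ≤ i) (hi' : i ≤ r) :
    word b (glue d σ τ) (l + 1 + i) = word 0 τ i + (if d then 0 else l) + 1 := by
  rw [word_glue d σ τ b (by omega) (by omega), glueWord, if_neg (by omega), if_neg (by omega),
    Nat.add_sub_cancel_left]

theorem glue_injective {σ σ' : Equiv.Perm (Fin l)} {τ τ' : Equiv.Perm (Fin r)}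
    (h : glue d σ τ = glue d σ' τ') : σ = σ' ∧ τ = τ' := by
  constructor
  · refine eq_of_word_eq 0 fun i hi hi' => ?_
    have := word_glue_left d σ τ 0 hi hi'
    rw [h, word_glue_left d σ' τ' 0 hi hi'] at this
    omega
  · refine eq_of_word_eq 0 fun i hi hi' => ?_
    have := word_glue_right d σ τ 0 hi hi'
    rw [h, word_glue_right d σ' τ' 0 hi hi'] at this
    omega

/-- Counting the descent before the final `0` makes the boundary harmless: the last descent of `σ`
becomes the descent onto the letter `1`, and the last descent of `τ` remains last. The letter `1`
itself is a descent only when it ends the word. -/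
theorem card_descents_glue :
    ((Finset.Icc 1 (l + 1 + r)).filter fun i =>
      word 0 (glue d σ τ) i > word 0 (glue d σ τ) (i + 1)).card =
    ((Finset.Icc 1 l).filter fun i => word 0 σ i > word 0 σ (i + 1)).card +
      (if r = 0 then 1 else 0) +
      ((Finset.Icc 1 r).filter fun i => word 0 τ i > word 0 τ (i + 1)).card := by
  simp only [Finset.card_filter]
  rw [sum_Icc_add_one_add]
  congr 1
  · congr 1
    · refine Finset.sum_congr rfl fun i hi => if_congr ?_ rfl rfl
      have hi := Finset.mem_Icc.1 hi
      rw [word_glue_left d σ τ 0 hi.1 hi.2]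
      have := one_le_word 0 σ hi.1 hi.2
      rcases hi.2.lt_or_eq with h | rfl
      · rw [word_glue_left d σ τ 0 (by omega) (show i + 1 ≤ _ from h)]
        omega
      · rw [word_glue_mid, word_of_not_mem 0 σ (i := i + 1) (by omega)]
        omega
    · refine if_congr ?_ rfl rfl
      rw [word_glue_mid]
      have := word_zero_pos_iff (glue d σ τ) (l + 1 + 1)
      omega
  · refine Finset.sum_congr rfl fun i hi => if_congr ?_ rfl rfl
    have hi := Finset.mem_Icc.1 hi
    rw [word_glue_right d σ τ 0 hi.1 hi.2]
    have := one_le_word 0 τ hi.1 hi.2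
    rcases hi.2.lt_or_eq with h | rfl
    · rw [add_assoc (l + 1), word_glue_right d σ τ 0 (by omega) (show i + 1 ≤ _ from h)]
      omega
    · rw [word_of_not_mem 0 τ (i := i + 1) (by omega), word_of_not_mem 0 (glue d σ τ) (by omega)]
      omega

theorem des_glue_of_eq_zero (hl : l = 0) : des (glue d σ τ) = des τ := by
  have h1 := card_descents_glue d σ τ
  rw [card_descents_zero _ (by omega)] at h1
  subst hl
  rw [Finset.Icc_eq_empty (by omega), Finset.filter_empty, Finset.card_empty] at h1
  rcases Nat.eq_zero_or_pos r with rfl | hr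
  · simp at h1
    rw [h1, des]
    simp
  · rw [card_descents_zero τ hr, if_neg (by omega)] at h1
    omega

theorem des_glue (hl : 1 ≤ l) (hr : 1 ≤ r) : des (glue d σ τ) = des σ + des τ + 1 := by
  have h1 := card_descents_glue d σ τ
  rw [card_descents_zero _ (by omega), card_descents_zero _ hl, card_descents_zero _ hr,
    if_neg (by omega)] at h1
  omega

/-- The letter `1` is below all others, so it replaces the `0` after `σ` and the `0` before `τ`
without changing any comparison. It is itself a double descent exactly when a letter precedes it and
none follows. -/
theorem dd_glue :
    dd (glue d σ τ) = dd σ + (if 1 ≤ l ∧ r = 0 then 1 else 0) + dd τ := by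
  simp only [dd, doubleDescents, Finset.card_filter]
  rw [sum_Icc_add_one_add]
  congr 1
  · congr 1
    · refine Finset.sum_congr rfl fun i hi => if_congr ?_ rfl rfl
      have hi := Finset.mem_Icc.1 hi
      rw [word_glue_left d σ τ 0 hi.1 hi.2]
      have := one_le_word 0 σ hi.1 hi.2
      have e1 : word 0 (glue d σ τ) (i + 1) < word 0 σ i + (if d then r else 0) + 1 ↔
          word 0 σ (i + 1) < word 0 σ i := by
        rcases hi.2.lt_or_eq with h | rfl
        · rw [word_glue_left d σ τ 0 (by omega) (show i + 1 ≤ _ from h)]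
          omega
        · rw [word_glue_mid, word_of_not_mem 0 σ (i := i + 1) (by omega)]
          omega
      refine and_congr ?_ e1
      rcases hi.1.lt_or_eq with h | rfl
      · rw [word_glue_left d σ τ 0 (by omega) (by omega)]
        omega
      · simp [word_of_not_mem]
    · refine if_congr ?_ rfl rfl
      rw [word_glue_mid, Nat.add_sub_cancel]
      have := word_zero_pos_iff (glue d σ τ) (l + 1 + 1)
      rcases Nat.eq_zero_or_pos l with rfl | hl
      · rw [word_of_not_mem 0 _ (by omega)]
        omega
      · rw [word_glue_left d σ τ 0 hl le_rfl]
        have := one_le_word 0 σ hl le_rfl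
        omega
  · refine Finset.sum_congr rfl fun i hi => if_congr ?_ rfl rfl
    have hi := Finset.mem_Icc.1 hi
    rw [word_glue_right d σ τ 0 hi.1 hi.2]
    have := one_le_word 0 τ hi.1 hi.2
    refine and_congr ?_ ?_
    · rcases hi.1.lt_or_eq with h | rfl
      · rw [Nat.add_sub_assoc hi.1, word_glue_right d σ τ 0 (by omega) (by omega)]
        omega
      · simp [word_of_not_mem, word_glue_mid]
    · rcases hi.2.lt_or_eq with h | rfl
      · rw [add_assoc (l + 1), word_glue_right d σ τ 0 (by omega) (show i + 1 ≤ _ from h)]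
        omega
      · rw [word_of_not_mem 0 τ (i := i + 1) (by omega), word_of_not_mem 0 (glue d σ τ) (by omega)]
        omega

/-- With the left block on top, the descent from the last letter of `σ'` onto `1` straddles every
letter of `τ'`. A descent inside `σ'` stays above all of `τ'`, and a descent inside `τ'` looks only
to the right. -/
theorem vinc31_2_glue :
    vinc31_2 (glue true σ τ) = vinc31_2 σ + (if 1 ≤ l then r else 0) + vinc31_2 τ := by
  simp only [vinc31_2, Finset.card_filter, Finset.sum_product]
  rw [sum_Icc_add_one_add]
  simp only [sum_Icc_add_one_add _ _ fun j => ite (_ < j ∧ _) _ _]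
  have hr : r = ∑ _j ∈ Finset.Icc 1 r, 1 := by simp
  -- The extra term is attributed to the descent at position `l`, so that the sums can be compared
  -- position by position.
  have hl : (if 1 ≤ l then r else 0) = ∑ i ∈ Finset.Icc 1 l, if l = i then r else 0 := by
    simp [Finset.sum_ite_eq]
  rw [hl, ← Finset.sum_add_distrib]
  refine congrArg₂ (· + ·) ((congrArg₂ (· + ·) ?_ ?_).trans (add_zero _)) ?_
  · refine Finset.sum_congr rfl fun i hi => ?_
    have hi := Finset.mem_Icc.1 hi
    have bi := one_le_word 0 σ hi.1 hi.2
    rw [word_glue_mid, word_glue_left true σ τ 0 hi.1 hi.2]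
    refine congrArg₂ (· + ·) ((congrArg₂ (· + ·) ?_ ?_).trans (add_zero _)) ?_
    · refine Finset.sum_congr rfl fun j hj => if_congr ?_ rfl rfl
      have hj := Finset.mem_Icc.1 hj
      rw [word_glue_left true σ τ 0 hj.1 hj.2]
      rcases hi.2.lt_or_eq with h | rfl
      · rw [word_glue_left true σ τ 0 (by omega) (show i + 1 ≤ l from h)]
        omega
      · omega
    · have := word_zero_pos_iff (glue true σ τ) (i + 1)
      exact if_neg (by omega)
    · rcases hi.2.lt_or_eq with h | rfl
      · rw [if_neg (show ¬l = i by omega)]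
        refine Finset.sum_eq_zero fun j hj => if_neg ?_
        have hj := Finset.mem_Icc.1 hj
        rw [word_glue_left true σ τ 0 (by omega) (show i + 1 ≤ l from h),
          word_glue_right true σ τ 0 hj.1 hj.2]
        have := word_zero_le τ j
        simp only [if_true]
        omega
      · refine (Finset.sum_congr rfl fun j hj => if_pos ?_).trans (hr.symm.trans (if_pos rfl).symm)
        have hj := Finset.mem_Icc.1 hj
        rw [word_glue_mid, word_glue_right true σ τ 0 hj.1 hj.2]
        have h1 := word_zero_le τ j
        have h2 := one_le_word 0 τ hj.1 hj.2
        simp only [if_true]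
        omega
  · rw [word_glue_mid]
    exact add_add_eq_left (Finset.sum_eq_zero fun j hj => if_neg (by omega)) (if_neg (by omega))
      (Finset.sum_eq_zero fun j hj => if_neg (by omega))
  · refine Finset.sum_congr rfl fun i hi => ?_
    have hi := Finset.mem_Icc.1 hi
    have bi := one_le_word 0 τ hi.1 hi.2
    refine add_add_eq_right (Finset.sum_eq_zero fun j hj => ?_) ?_ ?_
    · have hj := Finset.mem_Icc.1 hj
      exact if_neg (by omega)
    · exact if_neg (by omega)
    · refine Finset.sum_congr rfl fun j hj => if_congr ?_ rfl rfl
      have hj := Finset.mem_Icc.1 hj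
      rw [word_glue_right true σ τ 0 hi.1 hi.2, word_glue_right true σ τ 0 hj.1 hj.2]
      rcases hi.2.lt_or_eq with h | rfl
      · rw [add_assoc (l + 1), word_glue_right true σ τ 0 (by omega) (show i + 1 ≤ r from h)]
        omega
      · omega

/-- With the left block at the bottom, the ascent from `1` to the first letter of `τ'` straddles
every letter of `σ'`. Ascents inside `τ'` lie above all of `σ'`. -/
theorem vinc2_13_glue :
    vinc2_13 (glue false σ τ) = vinc2_13 σ + (if 1 ≤ r then l else 0) + vinc2_13 τ := by
  simp only [vinc2_13, Finset.card_filter, Finset.sum_product]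
  rw [sum_Icc_add_one_add]
  simp only [sum_Icc_add_one_add _ _ fun j => ite (j < _ ∧ _) _ _]
  refine congrArg₂ (· + ·) (congrArg₂ (· + ·) ?_ ?_) ?_
  · refine Finset.sum_congr rfl fun i hi => ?_
    have hi := Finset.mem_Icc.1 hi
    have bi := one_le_word 0 σ hi.1 hi.2
    rw [word_glue_left false σ τ 0 hi.1 hi.2]
    refine add_add_eq_left (Finset.sum_congr rfl fun j hj => ?_) (if_neg (by omega))
      (Finset.sum_eq_zero fun j hj => if_neg (by omega))
    refine if_congr ?_ rfl rfl
    have hj := Finset.mem_Icc.1 hj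
    rw [word_glue_left false σ τ 0 hj.1 hj.2]
    rcases hi.2.lt_or_eq with h | rfl
    · rw [word_glue_left false σ τ 0 (by omega) (show i + 1 ≤ l from h)]
      omega
    · rw [word_glue_mid]
      omega
  · rw [word_glue_mid]
    refine add_add_eq_left ?_ (if_neg (by omega))
      (Finset.sum_eq_zero fun j hj => if_neg (by omega))
    rcases Nat.eq_zero_or_pos r with hr | hr
    swap
    · rw [if_pos (show 1 ≤ r from hr)]
      refine (Finset.sum_congr rfl fun j hj => if_pos ?_).trans (by simp : _ = l)
      have hj := Finset.mem_Icc.1 hj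
      rw [word_glue_left false σ τ 0 hj.1 hj.2, word_glue_right false σ τ 0 le_rfl hr]
      have h1 := word_zero_le σ j
      have h2 := one_le_word 0 σ hj.1 hj.2
      have h3 := one_le_word 0 τ le_rfl hr
      simp only [Bool.false_eq_true, if_false]
      omega
    · rw [if_neg (show ¬1 ≤ r by omega)]
      exact Finset.sum_eq_zero fun j hj => if_neg (by omega)
  · refine Finset.sum_congr rfl fun i hi => ?_
    have hi := Finset.mem_Icc.1 hi
    have bi := one_le_word 0 τ hi.1 hi.2
    rw [word_glue_mid, word_glue_right false σ τ 0 hi.1 hi.2]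
    refine add_add_eq_right (Finset.sum_eq_zero fun j hj => if_neg ?_) (if_neg (by omega))
      (Finset.sum_congr rfl fun j hj => if_congr ?_ rfl rfl)
    · have hj := Finset.mem_Icc.1 hj
      rw [word_glue_left false σ τ 0 hj.1 hj.2]
      have h1 := word_zero_le σ j
      simp only [Bool.false_eq_true, if_false]
      omega
    · have hj := Finset.mem_Icc.1 hj
      rw [word_glue_right false σ τ 0 hj.1 hj.2]
      rcases hi.2.lt_or_eq with h | rfl
      · rw [add_assoc (l + 1), word_glue_right false σ τ 0 (by omega) (show i + 1 ≤ r from h)]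
        omega
      · omega

end Glue

/-! ### Avoiders of 213 and 312 as pairs of smaller avoiders -/

section MinimumDecomposition

variable {l r : ℕ}

/-- An occurrence not contained in one block would start in `σ'` and end at `1` or in `τ'` (the
letter `1` cannot play the `2`), but everything there is smaller than `σ'`. -/
theorem avoids_213_glue (σ : Equiv.Perm (Fin l)) (τ : Equiv.Perm (Fin r)) :
    Avoids (glue true σ τ) ![2, 1, 3] ↔ Avoids σ ![2, 1, 3] ∧ Avoids τ ![2, 1, 3] := by
  simp only [avoids_213_iff _ 0]
  constructor
  · refine fun h => ⟨fun i j k hi hij hjk hk h1 h2 => ?_, fun i j k hi hij hjk hk h1 h2 => ?_⟩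
    · refine h i j k hi hij hjk (by omega) ?_ ?_
      · rw [word_glue_left _ _ _ _ (by omega) (by omega),
          word_glue_left _ _ _ _ (by omega) (by omega)]
        omega
      · rw [word_glue_left _ _ _ _ (by omega) (by omega),
          word_glue_left _ _ _ _ (by omega) (by omega)]
        omega
    · refine h (l + 1 + i) (l + 1 + j) (l + 1 + k) (by omega) (by omega) (by omega) (by omega) ?_ ?_
      · rw [word_glue_right _ _ _ _ (by omega) (by omega),
          word_glue_right _ _ _ _ (by omega) (by omega)]
        omega
      · rw [word_glue_right _ _ _ _ (by omega) (by omega),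
          word_glue_right _ _ _ _ (by omega) (by omega)]
        omega
  · rintro ⟨hσ, hτ⟩ i j k hi hij hjk hk h1 h2
    by_cases hkl : k ≤ l
    · rw [word_glue_left _ _ _ _ (by omega) (by omega),
        word_glue_left _ _ _ _ (by omega) (by omega)] at h1 h2
      exact hσ i j k hi hij hjk hkl (by omega) (by omega)
    by_cases hil : l + 1 < i
    · obtain ⟨i, rfl⟩ := Nat.exists_eq_add_of_le hil.le
      obtain ⟨j, rfl⟩ := Nat.exists_eq_add_of_le (hil.trans hij).le
      obtain ⟨k, rfl⟩ := Nat.exists_eq_add_of_le (hil.trans (hij.trans hjk)).le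
      rw [word_glue_right _ _ _ _ (by omega) (by omega),
        word_glue_right _ _ _ _ (by omega) (by omega)] at h1 h2
      exact hτ i j k (by omega) (by omega) (by omega) (by omega) (by omega) (by omega)
    have hj := one_le_word 0 (glue true σ τ) (show 1 ≤ j by omega) (by omega)
    by_cases hi1 : i = l + 1
    · rw [hi1, word_glue_mid] at h1
      omega
    rw [word_glue_left _ _ _ _ hi (by omega)] at h2
    have hi' := one_le_word 0 σ hi (by omega)
    simp only [if_true] at h2
    by_cases hk1 : k = l + 1
    · rw [hk1, word_glue_mid] at h2
      omega
    · obtain ⟨k, rfl⟩ := Nat.exists_eq_add_of_le (show l + 1 ≤ k by omega)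
      rw [word_glue_right _ _ _ _ (by omega) (by omega)] at h2
      have := word_zero_le τ k
      simp only [if_true] at h2
      omega

theorem avoids_312_glue (σ : Equiv.Perm (Fin l)) (τ : Equiv.Perm (Fin r)) :
    Avoids (glue false σ τ) ![3, 1, 2] ↔ Avoids σ ![3, 1, 2] ∧ Avoids τ ![3, 1, 2] := by
  simp only [avoids_312_iff _ 0]
  constructor
  · refine fun h => ⟨fun i j k hi hij hjk hk h1 h2 => ?_, fun i j k hi hij hjk hk h1 h2 => ?_⟩
    · refine h i j k hi hij hjk (by omega) ?_ ?_
      · rw [word_glue_left _ _ _ _ (by omega) (by omega),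
          word_glue_left _ _ _ _ (by omega) (by omega)]
        omega
      · rw [word_glue_left _ _ _ _ (by omega) (by omega),
          word_glue_left _ _ _ _ (by omega) (by omega)]
        omega
    · refine h (l + 1 + i) (l + 1 + j) (l + 1 + k) (by omega) (by omega) (by omega) (by omega) ?_ ?_
      · rw [word_glue_right _ _ _ _ (by omega) (by omega),
          word_glue_right _ _ _ _ (by omega) (by omega)]
        omega
      · rw [word_glue_right _ _ _ _ (by omega) (by omega),
          word_glue_right _ _ _ _ (by omega) (by omega)]
        omega
  · rintro ⟨hσ, hτ⟩ i j k hi hij hjk hk h1 h2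
    by_cases hkl : k ≤ l
    · rw [word_glue_left _ _ _ _ (by omega) (by omega),
        word_glue_left _ _ _ _ (by omega) (by omega)] at h1 h2
      exact hσ i j k hi hij hjk hkl (by omega) (by omega)
    by_cases hil : l + 1 < i
    · obtain ⟨i, rfl⟩ := Nat.exists_eq_add_of_le hil.le
      obtain ⟨j, rfl⟩ := Nat.exists_eq_add_of_le (hil.trans hij).le
      obtain ⟨k, rfl⟩ := Nat.exists_eq_add_of_le (hil.trans (hij.trans hjk)).le
      rw [word_glue_right _ _ _ _ (by omega) (by omega),
        word_glue_right _ _ _ _ (by omega) (by omega)] at h1 h2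
      exact hτ i j k (by omega) (by omega) (by omega) (by omega) (by omega) (by omega)
    have hj := one_le_word 0 (glue false σ τ) (show 1 ≤ j by omega) (by omega)
    by_cases hk1 : k = l + 1
    · rw [hk1, word_glue_mid] at h1
      omega
    obtain ⟨k, rfl⟩ := Nat.exists_eq_add_of_le (show l + 1 ≤ k by omega)
    rw [word_glue_right _ _ _ _ (by omega) (by omega)] at h1 h2
    have hk' := one_le_word 0 τ (show 1 ≤ k by omega) (by omega)
    simp only [Bool.false_eq_true, if_false] at h1 h2
    by_cases hi1 : i = l + 1
    · rw [hi1, word_glue_mid] at h2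
      omega
    rw [word_glue_left _ _ _ _ hi (by omega)] at h2
    have := word_zero_le σ i
    simp only [Bool.false_eq_true, if_false] at h2
    omega

theorem exists_perm_word_eq {m : ℕ} (f : ℕ → ℕ) (hf : ∀ i, 1 ≤ i → i ≤ m → 1 ≤ f i ∧ f i ≤ m)
    (hinj : ∀ i j, 1 ≤ i → i ≤ m → 1 ≤ j → j ≤ m → f i = f j → i = j) :
    ∃ σ : Equiv.Perm (Fin m), ∀ i, 1 ≤ i → i ≤ m → word 0 σ i = f i := by
  have hb : ∀ i : Fin m, f (i + 1) - 1 < m := fun i => by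
    have := hf (i + 1) (by omega) (by omega)
    omega
  have hi : Function.Injective fun i : Fin m => (⟨f (i + 1) - 1, hb i⟩ : Fin m) := by
    intro i j h
    have h := congrArg Fin.val h
    have h1 := hf (i + 1) (by omega) (by omega)
    have h2 := hf (j + 1) (by omega) (by omega)
    have := hinj (i + 1) (j + 1) (by omega) (by omega) (by omega) (by omega)
      (by simp only at h; omega)
    exact Fin.ext (by omega)
  refine ⟨Equiv.ofBijective _ (Finite.injective_iff_bijective.1 hi), fun i h h' => ?_⟩
  obtain ⟨i, rfl⟩ : ∃ j, i = j + 1 := ⟨i - 1, by omega⟩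
  rw [word_of_mem 0 _ (show i < m by omega)]
  have := hf (i + 1) h h'
  simp only [Equiv.ofBijective_apply]
  omega

/-- A pigeonhole count, used to turn the relative order of the two blocks into exact ranges of
values. -/
theorem card_le_of_word_mem {n : ℕ} (π : Equiv.Perm (Fin n)) {a b c e : ℕ} (ha : 1 ≤ a)
    (hb : b ≤ n) (h : ∀ i, a ≤ i → i ≤ b → c ≤ word 0 π i ∧ word 0 π i ≤ e) :
    b + 1 - a ≤ e + 1 - c := by
  rw [← Nat.card_Icc, ← Nat.card_Icc]
  refine Finset.card_le_card_of_injOn (word 0 π) (fun i hi => ?_) fun i hi j hj hij => ?_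
  · have hi := Finset.mem_Icc.1 hi
    exact Finset.mem_coe.2 (Finset.mem_Icc.2 (h i hi.1 hi.2))
  · have hi := Finset.mem_Icc.1 hi
    have hj := Finset.mem_Icc.1 hj
    exact word_inj 0 π (by omega) (by omega) (by omega) (by omega) hij

theorem exists_eq_glue (d : Bool) (π : Equiv.Perm (Fin (l + 1 + r))) (hπ : word 0 π (l + 1) = 1)
    (h : ∀ i j, 1 ≤ i → i ≤ l → l + 1 < j → j ≤ l + 1 + r →
      if d then word 0 π j < word 0 π i else word 0 π i < word 0 π j) :
    ∃ (σ : Equiv.Perm (Fin l)) (τ : Equiv.Perm (Fin r)), π = glue d σ τ := by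
  have h2 : ∀ i, 1 ≤ i → i ≤ l + 1 + r → i ≠ l + 1 → 2 ≤ word 0 π i := by
    intro i hi hi' hne
    have h1 := one_le_word 0 π hi hi'
    by_contra hc
    exact hne (word_inj 0 π hi hi' (by omega) (by omega) (by omega))
  -- When the left block is on top, `1` and the `r` letters after it are all below `π(i)`; otherwise
  -- those `r` letters are all above it.
  have hL : ∀ i, 1 ≤ i → i ≤ l → (if d then r else 0) + 2 ≤ word 0 π i ∧
      word 0 π i ≤ (if d then r else 0) + 1 + l := by
    intro i hi hi'
    have a1 := word_zero_le π i
    have a2 := h2 i hi (by omega) (by omega)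
    cases d with
    | true =>
      simp only [if_true] at h ⊢
      have := card_le_of_word_mem π (a := l + 1) (b := l + 1 + r) (c := 1) (e := word 0 π i - 1)
        (by omega) le_rfl fun j hj hj' => by
          refine ⟨one_le_word 0 π (by omega) hj', ?_⟩
          rcases hj.eq_or_lt with rfl | hj
          · omega
          · have := h i j hi hi' hj hj'
            omega
      omega
    | false =>
      simp only [Bool.false_eq_true, if_false] at h ⊢
      have := card_le_of_word_mem π (a := l + 2) (b := l + 1 + r) (c := word 0 π i + 1)
        (e := l + 1 + r) (by omega) le_rfl fun j hj hj' =>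
          ⟨h i j hi hi' (by omega) hj', word_zero_le π j⟩
      omega
  have hR : ∀ j, 1 ≤ j → j ≤ r → (if d then 0 else l) + 2 ≤ word 0 π (l + 1 + j) ∧
      word 0 π (l + 1 + j) ≤ (if d then 0 else l) + 1 + r := by
    intro j hj hj'
    have a1 := word_zero_le π (l + 1 + j)
    have a2 := h2 (l + 1 + j) (by omega) (by omega) (by omega)
    cases d with
    | true =>
      simp only [if_true] at h ⊢
      have := card_le_of_word_mem π (a := 1) (b := l) (c := word 0 π (l + 1 + j) + 1)
        (e := l + 1 + r) (by omega) (by omega) fun i hi hi' =>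
          ⟨h i _ hi hi' (by omega) (by omega), word_zero_le π i⟩
      omega
    | false =>
      simp only [Bool.false_eq_true, if_false] at h ⊢
      have := card_le_of_word_mem π (a := 1) (b := l + 1) (c := 1)
        (e := word 0 π (l + 1 + j) - 1) (by omega) (by omega) fun i hi hi' => by
          refine ⟨one_le_word 0 π (by omega) (by omega), ?_⟩
          rcases hi'.eq_or_lt with rfl | hi'
          · omega
          · have := h i (l + 1 + j) hi (by omega) (by omega) (by omega)
            omega
      omega
  obtain ⟨σ, hσ⟩ := exists_perm_word_eq (m := l)
    (fun i => word 0 π i - 1 - if d then r else 0)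
    (fun i hi hi' => by have := hL i hi hi'; omega) fun i j hi hi' hj hj' hij => by
      have := hL i hi hi'
      have := hL j hj hj'
      exact word_inj 0 π hi (by omega) hj (by omega) (by omega)
  obtain ⟨τ, hτ⟩ := exists_perm_word_eq (m := r)
    (fun i => word 0 π (l + 1 + i) - 1 - if d then 0 else l)
    (fun i hi hi' => by have := hR i hi hi'; omega) fun i j hi hi' hj hj' hij => by
      have := hR i hi hi'
      have := hR j hj hj'
      have := word_inj 0 π (i := l + 1 + i) (j := l + 1 + j) (by omega) (by omega) (by omega)
        (by omega) (by omega)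
      omega
  refine ⟨σ, τ, eq_of_word_eq 0 fun i hi hi' => ?_⟩
  by_cases hil : i ≤ l
  · rw [word_glue_left _ _ _ _ hi hil, hσ i hi hil]
    have := hL i hi hil
    omega
  by_cases him : i = l + 1
  · rw [him, hπ, word_glue_mid]
  · obtain ⟨j, rfl⟩ := Nat.exists_eq_add_of_le (show l + 1 ≤ i by omega)
    rw [word_glue_right _ _ _ _ (by omega) (by omega), hτ j (by omega) (by omega)]
    have := hR j (by omega) (by omega)
    omega

/-- A letter before `1` that is smaller than a letter after it would complete a `213` with this `1`
in the middle. -/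
theorem exists_eq_glue_of_avoids_213 (π : Equiv.Perm (Fin (l + 1 + r)))
    (hπ : word 0 π (l + 1) = 1) (h : Avoids π ![2, 1, 3]) :
    ∃ (σ : Equiv.Perm (Fin l)) (τ : Equiv.Perm (Fin r)), π = glue true σ τ := by
  rw [avoids_213_iff _ 0] at h
  refine exists_eq_glue true π hπ fun i j hi hi' hj hj' => ?_
  have h1 := one_le_word 0 π hi (by omega)
  have h2 : word 0 π i ≠ 1 := fun h2 => by
    have := word_inj 0 π hi (by omega) (by omega) (by omega) (h2.trans hπ.symm)
    omega
  have h3 : word 0 π i ≠ word 0 π j := fun h3 => by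
    have := word_inj 0 π hi (by omega) (by omega) (by omega) h3
    omega
  have := h i (l + 1) j hi (by omega) hj hj' (by omega)
  simp only [if_true]
  omega

theorem exists_eq_glue_of_avoids_312 (π : Equiv.Perm (Fin (l + 1 + r)))
    (hπ : word 0 π (l + 1) = 1) (h : Avoids π ![3, 1, 2]) :
    ∃ (σ : Equiv.Perm (Fin l)) (τ : Equiv.Perm (Fin r)), π = glue false σ τ := by
  rw [avoids_312_iff _ 0] at h
  refine exists_eq_glue false π hπ fun i j hi hi' hj hj' => ?_
  have h1 := one_le_word 0 π (show 1 ≤ j by omega) (by omega)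
  have h2 : word 0 π j ≠ 1 := fun h2 => by
    have := word_inj 0 π (by omega) (by omega) (by omega) (by omega) (h2.trans hπ.symm)
    omega
  have h3 : word 0 π i ≠ word 0 π j := fun h3 => by
    have := word_inj 0 π hi (by omega) (by omega) (by omega) h3
    omega
  have := h i (l + 1) j hi (by omega) hj hj' (by omega)
  simp only [Bool.false_eq_true, if_false]
  omega

end MinimumDecomposition

/-! ### The Motzkin recurrence for 213 and 312 -/

section AvoidSum

variable (p : Fin 3 → ℕ) (st : ∀ n : ℕ, Equiv.Perm (Fin n) → ℕ)

open Classical in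
/-- The generating polynomial of `des` and `st` over the permutations that avoid `p` and have no
double descents. -/
noncomputable def avoidSum (n : ℕ) : ℤ[X][X] :=
  ∑ π ∈ Finset.univ.filter (fun π : Equiv.Perm (Fin n) => Avoids π p),
    if dd π = 0 then X ^ des π * C X ^ st n π else 0

theorem coeff_avoidSum (n k : ℕ) :
    (avoidSum p st n).coeff k = ∑ π ∈ tildeS p n k, X ^ st n π := by
  classical
  rw [avoidSum, finsetSum_coeff, tildeS, Finset.sum_filter, Finset.sum_filter]
  refine Finset.sum_congr rfl fun π _ => ?_
  have e : (X ^ des π * C X ^ st n π : ℤ[X][X]).coeff k =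
      if des π = k then X ^ st n π else 0 := by
    rw [← C_pow, coeff_mul_C, coeff_X_pow, ite_mul, one_mul, zero_mul]
    exact if_congr eq_comm rfl rfl
  by_cases h1 : Avoids π p <;> by_cases h2 : dd π = 0 <;> simp [h1, h2, e]

open Classical in
theorem sum_avoids_word_eq_one {p : Fin 3 → ℕ} {d : Bool} {l r : ℕ}
    (hav : ∀ (σ : Equiv.Perm (Fin l)) (τ : Equiv.Perm (Fin r)),
      Avoids (glue d σ τ) p ↔ Avoids σ p ∧ Avoids τ p)
    (hex : ∀ π : Equiv.Perm (Fin (l + 1 + r)), word 0 π (l + 1) = 1 → Avoids π p →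
      ∃ (σ : Equiv.Perm (Fin l)) (τ : Equiv.Perm (Fin r)), π = glue d σ τ)
    {M : Type*} [AddCommMonoid M] (f : Equiv.Perm (Fin (l + 1 + r)) → M) :
    ∑ π ∈ (Finset.univ.filter fun π : Equiv.Perm (Fin (l + 1 + r)) => Avoids π p).filter
        (fun π => word 0 π (l + 1) = 1), f π =
      ∑ σ ∈ Finset.univ.filter (fun σ : Equiv.Perm (Fin l) => Avoids σ p),
        ∑ τ ∈ Finset.univ.filter (fun τ : Equiv.Perm (Fin r) => Avoids τ p), f (glue d σ τ) := by
  rw [← Finset.sum_product']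
  symm
  refine Finset.sum_nbij (fun x => glue d x.1 x.2) ?_ ?_ ?_ fun _ _ => rfl
  · rintro ⟨σ, τ⟩ h
    simp only [Finset.mem_product, Finset.mem_filter, Finset.mem_univ, true_and] at h ⊢
    exact ⟨(hav σ τ).2 h, word_glue_mid d σ τ 0⟩
  · rintro ⟨σ, τ⟩ _ ⟨σ', τ'⟩ _ h
    obtain ⟨rfl, rfl⟩ := glue_injective d h
    rfl
  · intro π h
    simp only [Finset.coe_filter, Finset.mem_filter, Finset.mem_univ, true_and,
      Set.mem_ofPred_eq] at h
    obtain ⟨σ, τ, rfl⟩ := hex π h.2 h.1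
    refine ⟨(σ, τ), ?_, rfl⟩
    simpa [hav] using h.1

open Classical in
theorem sum_avoids_eq_sum_antidiagonal (p : Fin 3 → ℕ) (n : ℕ) {M : Type*} [AddCommMonoid M]
    (f : Equiv.Perm (Fin (n + 1)) → M) :
    ∑ π ∈ Finset.univ.filter (fun π : Equiv.Perm (Fin (n + 1)) => Avoids π p), f π =
      ∑ x ∈ Finset.HasAntidiagonal.antidiagonal n,
        ∑ π ∈ (Finset.univ.filter fun π : Equiv.Perm (Fin (n + 1)) => Avoids π p).filter
          (fun π => word 0 π (x.1 + 1) = 1), f π := by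
  rw [← Finset.sum_fiberwise_of_maps_to (t := Finset.HasAntidiagonal.antidiagonal n)
    (g := fun π : Equiv.Perm (Fin (n + 1)) => ((π.symm 0 : ℕ), n - (π.symm 0 : ℕ)))
    fun π _ => Finset.HasAntidiagonal.mem_antidiagonal.2 (by simp only; omega)]
  refine Finset.sum_congr rfl fun x hx => Finset.sum_congr (Finset.filter_congr fun π _ => ?_)
    fun _ _ => rfl
  obtain ⟨a, b⟩ := x
  have hx : a + b = n := Finset.HasAntidiagonal.mem_antidiagonal.1 hx
  rw [word_of_mem 0 π (show a < n + 1 by omega), Prod.mk.injEq]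
  have key : (π ⟨a, by omega⟩ : ℕ) = 0 ↔ (π.symm 0 : ℕ) = a := by
    constructor
    · intro h
      rw [show (0 : Fin (n + 1)) = π ⟨a, by omega⟩ from Fin.ext h.symm, Equiv.symm_apply_apply]
    · intro h
      rw [show (⟨a, by omega⟩ : Fin (n + 1)) = π.symm 0 from Fin.ext h.symm,
        Equiv.apply_symm_apply]
      rfl
  omega

variable {p st} {d : Bool} {e : ℕ → ℕ → ℕ}

/-- The summand `e l r` is the number of patterns created by gluing. Among the cuts, an empty left
block gives the first term, and a nonempty left block with an empty right block contributes nothing,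
since the final `1` is then a double descent. -/
theorem avoidSum_succ
    (hav : ∀ (l r : ℕ) (σ : Equiv.Perm (Fin l)) (τ : Equiv.Perm (Fin r)),
      Avoids (glue d σ τ) p ↔ Avoids σ p ∧ Avoids τ p)
    (hex : ∀ (l r : ℕ) (π : Equiv.Perm (Fin (l + 1 + r))), word 0 π (l + 1) = 1 → Avoids π p →
      ∃ (σ : Equiv.Perm (Fin l)) (τ : Equiv.Perm (Fin r)), π = glue d σ τ)
    (hst : ∀ (l r : ℕ) (σ : Equiv.Perm (Fin l)) (τ : Equiv.Perm (Fin r)),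
      st _ (glue d σ τ) = st l σ + e l r + st r τ)
    (h0 : ∀ σ : Equiv.Perm (Fin 0), st 0 σ = 0) (he : ∀ r, e 0 r = 0) (n : ℕ) :
    avoidSum p st (n + 1) = avoidSum p st n +
      ∑ x ∈ Finset.HasAntidiagonal.antidiagonal n, if 1 ≤ x.1 ∧ 1 ≤ x.2 then
        X * C X ^ e x.1 x.2 * (avoidSum p st x.1 * avoidSum p st x.2) else 0 := by
  classical
  have hdd0 : ∀ σ : Equiv.Perm (Fin 0), dd σ = 0 := fun σ => by simp [dd, doubleDescents]
  -- The size is a separate variable because `l + r = n` identifies `n + 1` with `l + 1 + r` only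
  -- propositionally.
  have key : ∀ N l r, (hN : N = l + 1 + r) →
      ∑ π ∈ (Finset.univ.filter fun π : Equiv.Perm (Fin N) => Avoids π p).filter
          (fun π => word 0 π (l + 1) = 1), (if dd π = 0 then X ^ des π * C X ^ st N π else 0) =
        if l = 0 then avoidSum p st r else if 1 ≤ l ∧ 1 ≤ r then
          X * C X ^ e l r * (avoidSum p st l * avoidSum p st r) else (0 : ℤ[X][X]) := by
    rintro N l r rfl
    rw [sum_avoids_word_eq_one (hav l r) (hex l r)]
    rcases Nat.eq_zero_or_pos l with rfl | hl
    · have : (Finset.univ.filter fun σ : Equiv.Perm (Fin 0) => Avoids σ p) = {1} := by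
        ext σ
        simp only [Finset.mem_filter, Finset.mem_univ, true_and, Finset.mem_singleton,
          Subsingleton.elim σ 1, iff_true]
        rintro ⟨f, _⟩
        exact (f 0).elim0
      rw [this, Finset.sum_singleton, if_pos rfl, avoidSum]
      refine Finset.sum_congr rfl fun τ _ => ?_
      rw [dd_glue, des_glue_of_eq_zero _ _ _ rfl, hst, h0, he, hdd0]
      simp
    · rw [if_neg (by omega)]
      rcases Nat.eq_zero_or_pos r with rfl | hr
      · rw [if_neg (by omega)]
        refine Finset.sum_eq_zero fun σ _ => Finset.sum_eq_zero fun τ _ => if_neg ?_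
        rw [dd_glue, if_pos ⟨hl, rfl⟩]
        omega
      · rw [if_pos ⟨hl, hr⟩, avoidSum, avoidSum, Finset.sum_mul_sum, Finset.mul_sum]
        refine Finset.sum_congr rfl fun σ _ => ?_
        rw [Finset.mul_sum]
        refine Finset.sum_congr rfl fun τ _ => ?_
        rw [dd_glue, des_glue _ _ _ hl hr, hst, if_neg (show ¬(1 ≤ l ∧ r = 0) by omega)]
        by_cases h1 : dd σ = 0 <;> by_cases h2 : dd τ = 0 <;> simp [h1, h2]
        ring
  rw [avoidSum, sum_avoids_eq_sum_antidiagonal]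
  rw [Finset.sum_congr rfl fun x hx => key (n + 1) x.1 x.2 (by
    have := Finset.HasAntidiagonal.mem_antidiagonal.1 hx; omega)]
  rw [Finset.Nat.sum_antidiagonal_eq_sum_range_succ_mk,
    Finset.Nat.sum_antidiagonal_eq_sum_range_succ_mk, Finset.sum_range_succ',
    Finset.sum_range_succ' (fun k => ite (1 ≤ k ∧ _) _ _)]
  simp [add_comm]

theorem isMotzkinSeq_avoidSum
    (hav : ∀ (l r : ℕ) (σ : Equiv.Perm (Fin l)) (τ : Equiv.Perm (Fin r)),
      Avoids (glue d σ τ) p ↔ Avoids σ p ∧ Avoids τ p)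
    (hex : ∀ (l r : ℕ) (π : Equiv.Perm (Fin (l + 1 + r))), word 0 π (l + 1) = 1 → Avoids π p →
      ∃ (σ : Equiv.Perm (Fin l)) (τ : Equiv.Perm (Fin r)), π = glue d σ τ)
    (hst : ∀ (l r : ℕ) (σ : Equiv.Perm (Fin l)) (τ : Equiv.Perm (Fin r)),
      st _ (glue d σ τ) = st l σ + e l r + st r τ)
    (h0 : ∀ σ : Equiv.Perm (Fin 0), st 0 σ = 0) (he : ∀ r, e 0 r = 0)
    (he' : (∀ l r, e (l + 1) (r + 1) = r + 1) ∨ ∀ l r, e (l + 1) (r + 1) = l + 1) :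
    IsMotzkinSeq 1 X (C X) fun m => avoidSum p st (m + 1) := by
  have hF0 : avoidSum p st 0 = 1 := by
    classical
    have : (Finset.univ.filter fun σ : Equiv.Perm (Fin 0) => Avoids σ p) = {1} := by
      ext σ
      simp only [Finset.mem_filter, Finset.mem_univ, true_and, Finset.mem_singleton,
        Subsingleton.elim σ 1, iff_true]
      rintro ⟨f, _⟩
      exact (f 0).elim0
    rw [avoidSum, this, Finset.sum_singleton, h0]
    simp [dd, doubleDescents, des]
  have hF1 : avoidSum p st 1 = 1 := by
    rw [avoidSum_succ hav hex hst h0 he, hF0]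
    simp
  refine ⟨hF1, ?_, fun m => ?_⟩
  · rw [avoidSum_succ hav hex hst h0 he, hF1]
    simp [Finset.Nat.antidiagonal_succ]
  -- Both extreme cuts drop out of the sum. The other blocks have sizes `x.1 + 1` and `x.2 + 1`,
  -- which accounts for the factor `q` outside the sum.
  · rw [avoidSum_succ hav hex hst h0 he, one_mul, Finset.Nat.antidiagonal_succ_succ']
    congr 1
    simp only [Finset.sum_cons, Finset.sum_map, Finset.mul_sum]
    simp only [nonpos_iff_eq_zero, one_ne_zero, false_and, and_false, if_false, zero_add,
      Function.Embedding.prodMap, Function.Embedding.coeFn_mk, Prod.map, Nat.succ_eq_add_one,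
      Nat.le_add_left, and_self, if_true]
    rcases he' with he' | he'
    · refine Finset.sum_congr rfl fun x _ => ?_
      simp only [he']
      ring
    -- The extra exponent comes from the left block here, whereas the recurrence has it on the
    -- second factor.
    · refine Eq.trans Finset.Nat.sum_antidiagonal_swap.symm ?_
      refine Finset.sum_congr rfl fun x _ => ?_
      simp only [he', Prod.fst_swap, Prod.snd_swap]
      ring

theorem isMotzkinSeq_avoidSum_213 :
    IsMotzkinSeq 1 X (C X) fun m => avoidSum ![2, 1, 3] (fun _ => vinc31_2) (m + 1) :=
  isMotzkinSeq_avoidSum (d := true) (e := fun l r => if 1 ≤ l then r else 0)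
    (fun _ _ => avoids_213_glue) (fun _ _ => exists_eq_glue_of_avoids_213)
    (fun _ _ => vinc31_2_glue) (fun σ => by simp [vinc31_2]) (fun r => by simp)
    (Or.inl fun l r => by simp)

theorem isMotzkinSeq_avoidSum_312 :
    IsMotzkinSeq 1 X (C X) fun m => avoidSum ![3, 1, 2] (fun _ => vinc2_13) (m + 1) :=
  isMotzkinSeq_avoidSum (d := false) (e := fun l r => if 1 ≤ r then l else 0)
    (fun _ _ => avoids_312_glue) (fun _ _ => exists_eq_glue_of_avoids_312)
    (fun _ _ => vinc2_13_glue) (fun σ => by simp [vinc2_13]) (fun r => by simp)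
    (Or.inr fun l r => by simp)

end AvoidSum

/-! ### Reverse-complement: from 213 and 312 to 132 and 231 -/

section ReverseComplement

variable {n : ℕ}

/-- The reverse-complement `π'(i) = n + 1 - π(n + 1 - i)`. -/
def revCompl (π : Equiv.Perm (Fin n)) : Equiv.Perm (Fin n) :=
  Fin.revPerm.trans (π.trans Fin.revPerm)

theorem revCompl_revCompl (π : Equiv.Perm (Fin n)) : revCompl (revCompl π) = π := by
  ext i
  simp [revCompl]

theorem word_revCompl (b b' : ℕ) (π : Equiv.Perm (Fin n)) {i : ℕ} (hi : 1 ≤ i) (hi' : i ≤ n) :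
    word b (revCompl π) i = n + 1 - word b' π (n + 1 - i) := by
  rw [word, word, dif_pos ⟨hi, hi'⟩, dif_pos ⟨by omega, by omega⟩]
  have e : Fin.rev (⟨i - 1, by omega⟩ : Fin n) = ⟨n + 1 - i - 1, by omega⟩ :=
    Fin.ext (by simp only [Fin.val_rev]; omega)
  simp only [revCompl, Equiv.trans_apply, Fin.revPerm_apply, e, Fin.val_rev]
  omega

theorem word_revCompl_boundary (π : Equiv.Perm (Fin n)) {i : ℕ} (hi : i ≤ n + 1) :
    word (n + 1) (revCompl π) i = n + 1 - word 0 π (n + 1 - i) := by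
  by_cases h : 1 ≤ i ∧ i ≤ n
  · exact word_revCompl _ _ π h.1 h.2
  · rw [word_of_not_mem _ _ h, word_of_not_mem _ _ (by omega)]
    rfl

theorem avoids_132_revCompl (π : Equiv.Perm (Fin n)) :
    Avoids (revCompl π) ![1, 3, 2] ↔ Avoids π ![2, 1, 3] := by
  rw [avoids_132_iff _ 0, avoids_213_iff _ 0]
  have hw := word_zero_le π
  constructor
  · intro h i j k hi hij hjk hk h1 h2
    refine h (n + 1 - k) (n + 1 - j) (n + 1 - i) (by omega) (by omega) (by omega) (by omega) ?_ ?_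
    all_goals
      rw [word_revCompl 0 0 π (by omega) (by omega), word_revCompl 0 0 π (by omega) (by omega),
        Nat.sub_sub_self (by omega), Nat.sub_sub_self (by omega)]
      have := hw i
      have := hw k
      omega
  · intro h i j k hi hij hjk hk h1 h2
    rw [word_revCompl 0 0 π (by omega) (by omega), word_revCompl 0 0 π (by omega) (by omega)]
      at h1 h2
    exact h (n + 1 - k) (n + 1 - j) (n + 1 - i) (by omega) (by omega) (by omega) (by omega)
      (by omega) (by omega)

theorem avoids_231_revCompl (π : Equiv.Perm (Fin n)) :
    Avoids (revCompl π) ![2, 3, 1] ↔ Avoids π ![3, 1, 2] := by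
  rw [avoids_231_iff _ 0, avoids_312_iff _ 0]
  have hw := word_zero_le π
  constructor
  · intro h i j k hi hij hjk hk h1 h2
    refine h (n + 1 - k) (n + 1 - j) (n + 1 - i) (by omega) (by omega) (by omega) (by omega) ?_ ?_
    all_goals
      rw [word_revCompl 0 0 π (by omega) (by omega), word_revCompl 0 0 π (by omega) (by omega),
        Nat.sub_sub_self (by omega), Nat.sub_sub_self (by omega)]
      have := hw i
      have := hw k
      omega
  · intro h i j k hi hij hjk hk h1 h2
    rw [word_revCompl 0 0 π (by omega) (by omega), word_revCompl 0 0 π (by omega) (by omega)]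
      at h1 h2
    exact h (n + 1 - k) (n + 1 - j) (n + 1 - i) (by omega) (by omega) (by omega) (by omega)
      (by omega) (by omega)

/-- Complementing exchanges the boundary values `0` and `n + 1`, and reversing afterwards restores
the direction of each descent. -/
theorem ddStar_revCompl (π : Equiv.Perm (Fin n)) : ddStar (revCompl π) = dd π := by
  have hw := word_zero_le π
  have key : ∀ i, 1 ≤ i → i ≤ n →
      ((word (n + 1) (revCompl π) (i - 1) > word (n + 1) (revCompl π) i ∧
        word (n + 1) (revCompl π) i > word (n + 1) (revCompl π) (i + 1)) ↔
      (word 0 π (n + 1 - i - 1) > word 0 π (n + 1 - i) ∧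
        word 0 π (n + 1 - i) > word 0 π (n + 1 - i + 1))) := by
    intro i hi hi'
    rw [word_revCompl_boundary π (by omega), word_revCompl_boundary π (by omega),
      word_revCompl_boundary π (by omega), show n + 1 - (i - 1) = n + 1 - i + 1 by omega,
      show n + 1 - (i + 1) = n + 1 - i - 1 by omega]
    have := hw (n + 1 - i - 1)
    have := hw (n + 1 - i)
    have := hw (n + 1 - i + 1)
    omega
  rw [ddStar, dd, doubleDescents, doubleDescents]
  refine Finset.card_nbij' (fun i => n + 1 - i) (fun i => n + 1 - i) ?_ ?_ ?_ ?_
  · intro i hi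
    simp only [Finset.coe_filter, Finset.mem_Icc, Set.mem_ofPred_eq] at hi ⊢
    exact ⟨by omega, (key i hi.1.1 hi.1.2).1 hi.2⟩
  · intro i hi
    simp only [Finset.coe_filter, Finset.mem_Icc, Set.mem_ofPred_eq] at hi ⊢
    refine ⟨by omega, (key (n + 1 - i) (by omega) (by omega)).2 ?_⟩
    rw [Nat.sub_sub_self (by omega)]
    exact hi.2
  · intro i hi
    simp only [Finset.coe_filter, Finset.mem_Icc, Set.mem_ofPred_eq] at hi
    simp only
    omega
  · intro i hi
    simp only [Finset.coe_filter, Finset.mem_Icc, Set.mem_ofPred_eq] at hi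
    simp only
    omega

theorem lt_of_descent {π : Equiv.Perm (Fin n)} {i : ℕ} (hi : 1 ≤ i) (hi' : i ≤ n)
    (h : word (n + 1) π i > word (n + 1) π (i + 1)) : i < n := by
  rcases hi'.lt_or_eq with h' | rfl
  · exact h'
  · have := word_le (i + 1) π hi le_rfl
    rw [word_of_not_mem _ _ (i := i + 1) (by omega)] at h
    omega

theorem des_revCompl (π : Equiv.Perm (Fin n)) : des (revCompl π) = des π := by
  have hw : ∀ {i}, 1 ≤ i → i ≤ n → word (n + 1) π i ≤ n := word_le (n + 1) π
  have key : ∀ i, 1 ≤ i → i < n →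
      (word (n + 1) (revCompl π) i > word (n + 1) (revCompl π) (i + 1) ↔
        word (n + 1) π (n - i) > word (n + 1) π (n - i + 1)) := by
    intro i hi hi'
    rw [word_revCompl (n + 1) (n + 1) π (by omega) (by omega),
      word_revCompl (n + 1) (n + 1) π (by omega) (by omega),
      show n + 1 - i = n - i + 1 by omega, show n + 1 - (i + 1) = n - i by omega]
    have := hw (show 1 ≤ n - i by omega) (by omega)
    have := hw (show 1 ≤ n - i + 1 by omega) (by omega)
    omega
  rw [des, des]
  refine Finset.card_nbij' (fun i => n - i) (fun i => n - i) ?_ ?_ ?_ ?_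
  · intro i hi
    simp only [Finset.coe_filter, Finset.mem_Icc, Set.mem_ofPred_eq] at hi ⊢
    have h := lt_of_descent hi.1.1 hi.1.2 hi.2
    exact ⟨by omega, (key i hi.1.1 h).1 hi.2⟩
  · intro i hi
    simp only [Finset.coe_filter, Finset.mem_Icc, Set.mem_ofPred_eq] at hi ⊢
    have h := lt_of_descent hi.1.1 hi.1.2 hi.2
    refine ⟨by omega, (key (n - i) (by omega) (by omega)).2 ?_⟩
    rw [Nat.sub_sub_self (by omega)]
    exact hi.2
  · intro i hi
    simp only [Finset.coe_filter, Finset.mem_Icc, Set.mem_ofPred_eq] at hi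
    simp only
    omega
  · intro i hi
    simp only [Finset.coe_filter, Finset.mem_Icc, Set.mem_ofPred_eq] at hi
    simp only
    omega

/-- The adjacent pair `i, i + 1` goes to `n - i, n - i + 1`, so it is indexed by `n - i`, while the
single position `j` goes to `n + 1 - j`. -/
theorem vinc2_31_revCompl (π : Equiv.Perm (Fin n)) : vinc2_31 (revCompl π) = vinc31_2 π := by
  have hw := word_zero_le π
  have key : ∀ i j, 1 ≤ i → i < n → 1 ≤ j → j ≤ n →
      (word 0 (revCompl π) (i + 1) < word 0 (revCompl π) j ∧
          word 0 (revCompl π) j < word 0 (revCompl π) i ↔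
        word 0 π (n - i + 1) < word 0 π (n + 1 - j) ∧ word 0 π (n + 1 - j) < word 0 π (n - i)) := by
    intro i j hi hi' hj hj'
    rw [word_revCompl 0 0 π (by omega) (by omega), word_revCompl 0 0 π (by omega) (by omega),
      word_revCompl 0 0 π (by omega) (by omega), show n + 1 - i = n - i + 1 by omega,
      show n + 1 - (i + 1) = n - i by omega]
    have := hw (n - i)
    have := hw (n - i + 1)
    have := hw (n + 1 - j)
    omega
  refine Finset.card_nbij' (fun x => (n - x.1, n + 1 - x.2)) (fun x => (n - x.1, n + 1 - x.2))
    ?_ ?_ ?_ ?_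
  · rintro ⟨i, j⟩ hx
    simp only [Finset.coe_filter, Finset.mem_product, Finset.mem_Icc, Set.mem_ofPred_eq] at hx ⊢
    obtain ⟨⟨hi, hj⟩, h1, h2, h3⟩ := hx
    exact ⟨by omega, by omega, (key i j hi.1 h2 hj.1 hj.2).1 h3⟩
  · rintro ⟨i, j⟩ hx
    simp only [Finset.coe_filter, Finset.mem_product, Finset.mem_Icc, Set.mem_ofPred_eq] at hx ⊢
    obtain ⟨⟨hi, hj⟩, h1, h3⟩ := hx
    refine ⟨by omega, by omega, by omega,
      (key (n - i) (n + 1 - j) (by omega) (by omega) (by omega) (by omega)).2 ?_⟩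
    rw [Nat.sub_sub_self (by omega), Nat.sub_sub_self (by omega)]
    exact h3
  · rintro ⟨i, j⟩ hx
    simp only [Finset.coe_filter, Finset.mem_product, Finset.mem_Icc, Set.mem_ofPred_eq] at hx
    simp only [Prod.mk.injEq]
    omega
  · rintro ⟨i, j⟩ hx
    simp only [Finset.coe_filter, Finset.mem_product, Finset.mem_Icc, Set.mem_ofPred_eq] at hx
    simp only [Prod.mk.injEq]
    omega

theorem vinc13_2_revCompl (π : Equiv.Perm (Fin n)) : vinc13_2 (revCompl π) = vinc2_13 π := by
  have hw := word_zero_le π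
  have key : ∀ i j, 1 ≤ i → i < n → 1 ≤ j → j ≤ n →
      (word 0 (revCompl π) i < word 0 (revCompl π) j ∧
          word 0 (revCompl π) j < word 0 (revCompl π) (i + 1) ↔
        word 0 π (n - i) < word 0 π (n + 1 - j) ∧ word 0 π (n + 1 - j) < word 0 π (n - i + 1)) := by
    intro i j hi hi' hj hj'
    rw [word_revCompl 0 0 π (by omega) (by omega), word_revCompl 0 0 π (by omega) (by omega),
      word_revCompl 0 0 π (by omega) (by omega), show n + 1 - i = n - i + 1 by omega,
      show n + 1 - (i + 1) = n - i by omega]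
    have := hw (n - i)
    have := hw (n - i + 1)
    have := hw (n + 1 - j)
    omega
  refine Finset.card_nbij' (fun x => (n - x.1, n + 1 - x.2)) (fun x => (n - x.1, n + 1 - x.2))
    ?_ ?_ ?_ ?_
  · rintro ⟨i, j⟩ hx
    simp only [Finset.coe_filter, Finset.mem_product, Finset.mem_Icc, Set.mem_ofPred_eq] at hx ⊢
    obtain ⟨⟨hi, hj⟩, h1, h3⟩ := hx
    exact ⟨by omega, by omega, by omega, (key i j hi.1 (by omega) hj.1 hj.2).1 h3⟩
  · rintro ⟨i, j⟩ hx
    simp only [Finset.coe_filter, Finset.mem_product, Finset.mem_Icc, Set.mem_ofPred_eq] at hx ⊢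
    obtain ⟨⟨hi, hj⟩, h1, h2, h3⟩ := hx
    refine ⟨by omega, by omega,
      (key (n - i) (n + 1 - j) (by omega) (by omega) (by omega) (by omega)).2 ?_⟩
    rw [Nat.sub_sub_self (by omega), Nat.sub_sub_self (by omega)]
    exact h3
  · rintro ⟨i, j⟩ hx
    simp only [Finset.coe_filter, Finset.mem_product, Finset.mem_Icc, Set.mem_ofPred_eq] at hx
    simp only [Prod.mk.injEq]
    omega
  · rintro ⟨i, j⟩ hx
    simp only [Finset.coe_filter, Finset.mem_product, Finset.mem_Icc, Set.mem_ofPred_eq] at hx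
    simp only [Prod.mk.injEq]
    omega

theorem sum_tildeStarS_eq_sum_tildeS {p p' : Fin 3 → ℕ}
    (hp : ∀ π : Equiv.Perm (Fin n), Avoids (revCompl π) p' ↔ Avoids π p) (k : ℕ) {M : Type*}
    [AddCommMonoid M] (f : Equiv.Perm (Fin n) → M) :
    ∑ π ∈ tildeStarS p' n k, f π = ∑ π ∈ tildeS p n k, f (revCompl π) := by
  classical
  symm
  have hmem : ∀ π : Equiv.Perm (Fin n), revCompl π ∈ tildeStarS p' n k ↔ π ∈ tildeS p n k := by
    intro π
    simp [tildeStarS, tildeS, hp, ddStar_revCompl, des_revCompl]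
  refine Finset.sum_nbij' revCompl revCompl (fun π h => (hmem π).2 h) (fun π h => ?_)
    (fun π _ => revCompl_revCompl π) (fun π _ => revCompl_revCompl π) fun _ _ => rfl
  rw [← hmem, revCompl_revCompl]
  exact h

end ReverseComplement

/-! ### Excedances of 321-avoiding permutations -/

section Excedances

variable {n : ℕ} (π : Equiv.Perm (Fin n))

/-- The smaller letters to the left of position `i` are counted twice: among the `π i` smaller
letters, and among the `i` letters to the left. -/
theorem card_inversions_right_add (i : Fin n) :
    (Finset.univ.filter fun j => i < j ∧ π j < π i).card + i =
      (Finset.univ.filter fun j => j < i ∧ π i < π j).card + π i := by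
  have h1 : (Finset.univ.filter fun j => π j < π i).card = π i := by
    rw [← Fin.card_Iio (π i)]
    refine Finset.card_nbij π (fun j hj => ?_) π.injective.injOn fun v hv => ?_
    · simpa using hj
    · exact ⟨π.symm v, by simpa using hv, by simp⟩
  have h2 := Fin.card_Iio i
  rw [← Finset.card_filter_add_card_filter_not (fun j => i < j), Finset.filter_filter,
    Finset.filter_filter] at h1
  rw [← Finset.card_filter_add_card_filter_not (fun j => π i < π j)] at h2
  have e1 : (Finset.univ.filter fun j => π j < π i ∧ i < j) =
      Finset.univ.filter fun j => i < j ∧ π j < π i := by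
    ext j; simp [and_comm]
  have e2 : ((Finset.Iio i).filter fun j => π i < π j) =
      Finset.univ.filter fun j => j < i ∧ π i < π j := by
    ext j; simp
  have e3 : (Finset.univ.filter fun j => π j < π i ∧ ¬i < j) =
      (Finset.Iio i).filter fun j => ¬π i < π j := by
    ext j
    simp only [Finset.mem_filter, Finset.mem_univ, true_and, Finset.mem_Iio, not_lt]
    constructor
    · rintro ⟨h, h'⟩
      exact ⟨lt_of_le_of_ne h' (by rintro rfl; exact h.ne rfl), h.le⟩
    · rintro ⟨h, h'⟩
      exact ⟨lt_of_le_of_ne h' (fun he => h.ne (π.injective he)), h.le⟩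
  rw [e1, e3] at h1
  rw [e2] at h2
  omega

theorem inv_eq_sum : inv π = ∑ i, (Finset.univ.filter fun j => i < j ∧ π j < π i).card := by
  simp only [inv, Finset.card_filter, ← Finset.univ_product_univ, Finset.sum_product]

variable {π}

theorem card_inversions_eq_zero_or (h : Avoids π ![3, 2, 1]) (i : Fin n) :
    (Finset.univ.filter fun j => i < j ∧ π j < π i).card = 0 ∨
      (Finset.univ.filter fun j => j < i ∧ π i < π j).card = 0 := by
  rw [avoids_321_iff] at h
  by_contra! hc
  obtain ⟨k, hk⟩ := Finset.card_pos.1 (Nat.pos_of_ne_zero hc.1)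
  obtain ⟨j, hj⟩ := Finset.card_pos.1 (Nat.pos_of_ne_zero hc.2)
  simp only [Finset.mem_filter, Finset.mem_univ, true_and] at hj hk
  exact h j i k hj.1 hk.1 hj.2 hk.2

/-- No letter has both a larger one to its left and a smaller one to its right. By the previous
count, an excedance at `i` therefore has exactly `π i - i` smaller letters to its right, and a
nonexcedance has none. -/
theorem inv_sub_exc (h : Avoids π ![3, 2, 1]) :
    inv π - exc π = ∑ i ∈ Finset.univ.filter (fun i => i < π i), ((π i : ℕ) - i - 1) := by
  have h1 : inv π = ∑ i ∈ Finset.univ.filter (fun i => i < π i), ((π i : ℕ) - i) := by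
    rw [inv_eq_sum, Finset.sum_filter]
    refine Finset.sum_congr rfl fun i _ => ?_
    have h1 := card_inversions_right_add π i
    have h2 := card_inversions_eq_zero_or h i
    by_cases hi : i < π i
    · rw [if_pos hi]
      have := Fin.lt_def.1 hi
      omega
    · rw [if_neg hi]
      have := Fin.le_def.1 (not_lt.1 hi)
      omega
  have h2 : inv π = ∑ i ∈ Finset.univ.filter (fun i => i < π i), ((π i : ℕ) - i - 1) + exc π := by
    rw [h1, exc, Finset.card_eq_sum_ones, ← Finset.sum_add_distrib]
    refine Finset.sum_congr rfl fun i hi => ?_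
    have : (i : ℕ) < π i := (Finset.mem_filter.1 hi).2
    omega
  omega

theorem strictMonoOn_excedances (h : Avoids π ![3, 2, 1]) :
    StrictMonoOn π (Finset.univ.filter fun i => i < π i : Finset (Fin n)) := by
  intro i hi j hj hij
  simp only [Finset.coe_filter, Finset.mem_univ, true_and, Set.mem_ofPred_eq, Fin.lt_def] at hj
  by_contra hc
  have hlt : π j < π i := lt_of_le_of_ne (not_lt.1 hc) fun he => hij.ne' (π.injective he)
  have h1 := card_inversions_right_add π j
  have h2 := card_inversions_eq_zero_or h j
  have h3 : 0 < (Finset.univ.filter fun k => k < j ∧ π j < π k).card :=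
    Finset.card_pos.2 ⟨i, by simp [hij, hlt]⟩
  omega

theorem strictMonoOn_nonexcedances (h : Avoids π ![3, 2, 1]) :
    StrictMonoOn π ((Finset.univ.filter fun i => i < π i)ᶜ : Finset (Fin n)) := by
  intro i hi j hj hij
  simp only [Finset.coe_compl, Finset.coe_filter, Finset.mem_univ, true_and, Set.mem_compl_iff,
    Set.mem_ofPred_eq, Fin.lt_def] at hi
  by_contra hc
  have hlt : π j < π i := lt_of_le_of_ne (not_lt.1 hc) fun he => hij.ne' (π.injective he)
  have h1 := card_inversions_right_add π i
  have h2 := card_inversions_eq_zero_or h i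
  have h3 : 0 < (Finset.univ.filter fun k => i < k ∧ π k < π i).card :=
    Finset.card_pos.2 ⟨j, by simp [hij, hlt]⟩
  omega

/-- Every inversion has exactly one end in `S`, which is impossible for three mutually inverted
positions. -/
theorem avoids_321_of_strictMonoOn {S : Finset (Fin n)} (h1 : StrictMonoOn π S)
    (h2 : StrictMonoOn π (Sᶜ : Finset (Fin n))) : Avoids π ![3, 2, 1] := by
  rw [avoids_321_iff]
  intro i j k hij hjk hji hkj
  have key : ∀ x y, x < y → π y < π x → (x ∈ S ↔ y ∉ S) := by
    intro x y hxy hyx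
    by_cases hx : x ∈ S <;> by_cases hy : y ∈ S
    · exact absurd (h1 hx hy hxy) hyx.not_gt
    · simp [hx, hy]
    · simp [hx, hy]
    · exact absurd (h2 (by simpa using hx) (by simpa using hy) hxy) hyx.not_gt
  have a := key i j hij hji
  have b := key j k hjk hkj
  have c := key i k (hij.trans hjk) (hkj.trans hji)
  tauto

theorem eqOn_of_strictMonoOn {S T : Finset (Fin n)} {f g : Fin n → Fin n}
    (hf : StrictMonoOn f S) (hg : StrictMonoOn g S) (hfT : ∀ x ∈ S, f x ∈ T)
    (hgT : ∀ x ∈ S, g x ∈ T) (hc : T.card = S.card) : Set.EqOn f g S := by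
  intro x hx
  obtain ⟨y, rfl⟩ : x ∈ Set.range (S.orderEmbOfFin rfl) := by
    rw [Finset.range_orderEmbOfFin]; exact hx
  have h1 := Finset.orderEmbOfFin_unique hc (f := f ∘ S.orderEmbOfFin rfl)
    (fun z => hfT _ (S.orderEmbOfFin_mem rfl z)) fun a b hab =>
      hf (S.orderEmbOfFin_mem rfl a) (S.orderEmbOfFin_mem rfl b)
        ((S.orderEmbOfFin rfl).strictMono hab)
  have h2 := Finset.orderEmbOfFin_unique hc (f := g ∘ S.orderEmbOfFin rfl)
    (fun z => hgT _ (S.orderEmbOfFin_mem rfl z)) fun a b hab =>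
      hg (S.orderEmbOfFin_mem rfl a) (S.orderEmbOfFin_mem rfl b)
        ((S.orderEmbOfFin rfl).strictMono hab)
  exact (congrFun h1 y).trans (congrFun h2 y).symm

theorem exists_perm_strictMonoOn (E T : Finset (Fin n)) (h : E.card = T.card) :
    ∃ π : Equiv.Perm (Fin n), (∀ x, π x ∈ T ↔ x ∈ E) ∧ StrictMonoOn π E ∧
      StrictMonoOn π (Eᶜ : Finset (Fin n)) := by
  have h' : Eᶜ.card = Tᶜ.card := by rw [Finset.card_compl, Finset.card_compl, h]
  let e : E ≃o T := (E.orderIsoOfFin h).symm.trans (T.orderIsoOfFin rfl)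
  let e' : (Eᶜ : Finset (Fin n)) ≃o (Tᶜ : Finset (Fin n)) :=
    (Eᶜ.orderIsoOfFin h').symm.trans (Tᶜ.orderIsoOfFin rfl)
  let f : Fin n → Fin n := fun x =>
    if hx : x ∈ E then e ⟨x, hx⟩ else e' ⟨x, Finset.mem_compl.2 hx⟩
  have f1 : ∀ x (hx : x ∈ E), f x = e ⟨x, hx⟩ := fun x hx => dif_pos hx
  have f2 : ∀ x (hx : x ∈ Eᶜ), f x = e' ⟨x, hx⟩ := fun x hx => dif_neg (Finset.mem_compl.1 hx)
  have hT : ∀ x, f x ∈ T ↔ x ∈ E := by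
    intro x
    by_cases hx : x ∈ E
    · simp only [hx, f1 x hx, iff_true]
      exact (e ⟨x, hx⟩).2
    · have hx' := Finset.mem_compl.2 hx
      simp only [hx, f2 x hx', iff_false]
      exact Finset.mem_compl.1 (e' ⟨x, hx'⟩).2
  have hinj : Function.Injective f := by
    intro x y hxy
    have hiff : x ∈ E ↔ y ∈ E := by rw [← hT, ← hT, hxy]
    by_cases hx : x ∈ E
    · rw [f1 x hx, f1 y (hiff.1 hx)] at hxy
      exact congrArg Subtype.val (e.injective (Subtype.ext hxy))
    · have hx' := Finset.mem_compl.2 hx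
      have hy' := Finset.mem_compl.2 (mt hiff.2 hx)
      rw [f2 x hx', f2 y hy'] at hxy
      exact congrArg Subtype.val (e'.injective (Subtype.ext hxy))
  refine ⟨Equiv.ofBijective f (Finite.injective_iff_bijective.1 hinj), hT, ?_, ?_⟩
  · intro x hx y hy hxy
    rw [Equiv.ofBijective_apply, Equiv.ofBijective_apply, f1 x hx, f1 y hy]
    exact e.strictMono (Subtype.mk_lt_mk.2 hxy)
  · intro x hx y hy hxy
    rw [Equiv.ofBijective_apply, Equiv.ofBijective_apply, f2 x hx, f2 y hy]
    exact e'.strictMono (Subtype.mk_lt_mk.2 hxy)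

theorem card_filter_lt_eq {S U : Finset (Fin n)} (hS : ∀ x, π x ∈ U ↔ x ∈ S)
    (hπ : StrictMonoOn π S) {x : Fin n} (hx : x ∈ S) :
    (U.filter fun v => v < π x).card = (S.filter fun y => y < x).card := by
  symm
  refine Finset.card_nbij π (fun y hy => ?_) π.injective.injOn fun v hv => ?_
  · simp only [Finset.coe_filter, Set.mem_ofPred_eq] at hy ⊢
    exact ⟨(hS y).2 hy.1, hπ hy.1 hx hy.2⟩
  · simp only [Finset.coe_filter, Set.mem_ofPred_eq] at hv
    have hy : π.symm v ∈ S := by rw [← hS]; simpa using hv.1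
    refine ⟨π.symm v, ?_, by simp⟩
    simp only [Finset.coe_filter, Set.mem_ofPred_eq]
    exact ⟨hy, (hπ.lt_iff_lt hy hx).1 (by simpa using hv.2)⟩

theorem card_filter_add_card_compl_filter (S : Finset (Fin n)) (P : Fin n → Prop)
    [DecidablePred P] :
    (S.filter P).card + (Sᶜ.filter P).card = (Finset.univ.filter P).card := by
  rw [← Finset.card_union_of_disjoint (Finset.disjoint_filter_filter disjoint_compl_right),
    ← Finset.filter_union, Finset.union_compl]

/-- Ranks are preserved on each of the two sets. If `x ∈ E` had `π x ≤ x`, then `T` would have more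
elements up to `x` than `E` has below `x`. If `x ∉ E` had `π x > x`, then `Tᶜ` would have at most as
many elements up to `x` as `Eᶜ` has below `x`; adding the ballot inequality gives `x + 1 ≤ x`. -/
theorem lt_apply_iff_of_ballot {E T : Finset (Fin n)} (hE : ∀ x, π x ∈ T ↔ x ∈ E)
    (h1 : StrictMonoOn π E) (h2 : StrictMonoOn π (Eᶜ : Finset (Fin n)))
    (hb : ∀ x, (T.filter fun v => v ≤ x).card ≤ (E.filter fun y => y < x).card) (x : Fin n) :
    x < π x ↔ x ∈ E := by
  have hbx := hb x
  by_cases hx : x ∈ E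
  · simp only [hx, iff_true]
    by_contra hc
    have h3 := card_filter_lt_eq hE h1 hx
    have h4 : (T.filter fun v => v < π x).card < (T.filter fun v => v ≤ x).card := by
      refine Finset.card_lt_card ((Finset.ssubset_iff_of_subset fun v hv => ?_).2
        ⟨π x, ?_, ?_⟩)
      · rw [Finset.mem_filter] at hv ⊢
        exact ⟨hv.1, hv.2.le.trans (not_lt.1 hc)⟩
      · exact Finset.mem_filter.2 ⟨(hE x).2 hx, not_lt.1 hc⟩
      · simp
    omega
  · simp only [hx, iff_false]
    intro hc
    have h3 := card_filter_lt_eq (U := Tᶜ) (fun y => by simp [hE]) h2 (Finset.mem_compl.2 hx)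
    have h4 : (Tᶜ.filter fun v => v ≤ x).card ≤ (Tᶜ.filter fun v => v < π x).card :=
      Finset.card_le_card fun v hv => by
        rw [Finset.mem_filter] at hv ⊢
        exact ⟨hv.1, hv.2.trans_lt hc⟩
    have h5 : (T.filter fun v => v ≤ x).card + (Tᶜ.filter fun v => v ≤ x).card = x + 1 := by
      rw [card_filter_add_card_compl_filter, Finset.filter_ge_eq_Iic, Fin.card_Iic]
    have h6 : (E.filter fun v => v < x).card + (Eᶜ.filter fun v => v < x).card = x := by
      rw [card_filter_add_card_compl_filter, Finset.filter_gt_eq_Iio, Fin.card_Iio]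
    omega

end Excedances

/-! ### Motzkin paths as words of signs -/

section Paths

/-- The steps `w` lead from height `h` to height `0`, and the heights before all of them are
nonnegative. -/
def IsPath : ∀ m : ℕ, ℤ → (Fin m → SignType) → Prop
  | 0, h, _ => h = 0
  | m + 1, h, w => 0 ≤ h ∧ IsPath m (h + w 0) (Fin.tail w)

theorem IsPath.nonneg {m : ℕ} {h : ℤ} {w : Fin m → SignType} (hw : IsPath m h w) : 0 ≤ h := by
  cases m with
  | zero => exact (show h = 0 from hw).ge
  | succ m => exact hw.1

theorem isPath_iff {m : ℕ} {h : ℤ} {w : Fin m → SignType} :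
    IsPath m h w ↔
      (∀ i ≤ m, 0 ≤ h + ∑ j : Fin m, if (j : ℕ) < i then (w j : ℤ) else 0) ∧
        h + ∑ j, (w j : ℤ) = 0 := by
  induction m generalizing h with
  | zero => simp [IsPath]; omega
  | succ m ih =>
    rw [IsPath, ih]
    simp only [Fin.sum_univ_succ, Fin.tail, Fin.val_zero, Fin.val_succ, ← add_assoc]
    constructor
    · rintro ⟨h0, h1, h2⟩
      refine ⟨fun i hi => ?_, h2⟩
      cases i with
      | zero => simpa using h0
      | succ i => simpa using h1 i (by omega)
    · rintro ⟨h1, h2⟩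
      exact ⟨by simpa using h1 0 (by omega), fun i hi => by simpa using h1 (i + 1) (by omega), h2⟩

/-- The sum of the heights after each of the steps `w`, starting from height `h`. -/
def heightSum {m : ℕ} (h : ℤ) (w : Fin m → SignType) : ℤ :=
  m * h + ∑ j : Fin m, ((m : ℤ) - (j : ℕ)) * (w j : ℤ)

/-- This confirms the closed form: in a path of `m` steps, step `j` enters the `m - j` heights that
follow it. -/
theorem heightSum_succ {m : ℕ} (h : ℤ) (w : Fin (m + 1) → SignType) :
    heightSum h w = (h + w 0) + heightSum (h + w 0) (Fin.tail w) := by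
  simp only [heightSum, Fin.sum_univ_succ, Fin.tail, Fin.val_zero, Fin.val_succ]
  push_cast
  rw [Finset.sum_congr rfl fun (j : Fin m) _ => show ((m : ℤ) + 1 - ((j : ℕ) + 1)) * (w j.succ : ℤ) =
    ((m : ℤ) - (j : ℕ)) * (w j.succ : ℤ) by ring]
  ring

theorem IsPath.heightSum_nonneg {m : ℕ} {h : ℤ} {w : Fin m → SignType} (hw : IsPath m h w) :
    0 ≤ heightSum h w := by
  induction m generalizing h with
  | zero => simp [heightSum]
  | succ m ih =>
    rw [heightSum_succ]
    exact add_nonneg hw.2.nonneg (ih hw.2)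

theorem sum_fin_succ_eq_sum_cons {α M : Type*} [Fintype α] [AddCommMonoid M] {m : ℕ}
    (f : (Fin (m + 1) → α) → M) :
    ∑ w, f w = ∑ a, ∑ w : Fin m → α, f (Fin.cons a w : Fin (m + 1) → α) := by
  rw [← (Fin.consEquiv fun _ : Fin (m + 1) => α).sum_comp, Fintype.sum_prod_type]
  rfl

open Classical in
theorem sum_isPath {R : Type*} [CommRing R] (t q : R) (m h : ℕ) :
    ∑ w ∈ Finset.univ.filter (fun w : Fin m → SignType => IsPath m h w),
      t ^ (Finset.univ.filter fun j => w j = 1).card * q ^ (heightSum h w).toNat =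
      pathSum t q m h := by
  induction m generalizing h with
  | zero =>
    rw [Finset.sum_filter, Fintype.sum_unique]
    simp [IsPath, pathSum, heightSum]
  | succ m ih =>
    have key : ∀ (a : SignType) (h' : ℕ), (h : ℤ) + a = h' →
        ∑ w : Fin m → SignType, (if IsPath (m + 1) h (Fin.cons a w : Fin (m + 1) → SignType) then
          t ^ (Finset.univ.filter fun j => (Fin.cons a w : Fin (m + 1) → SignType) j = 1).card *
            q ^ (heightSum h (Fin.cons a w : Fin (m + 1) → SignType)).toNat else 0) =
        t ^ (if a = 1 then 1 else 0) * q ^ h' * pathSum t q m h' := by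
      intro a h' ha
      rw [← ih, Finset.sum_filter, Finset.mul_sum]
      refine Finset.sum_congr rfl fun w _ => ?_
      simp only [IsPath, Fin.cons_zero, Fin.tail_cons, ha, Nat.cast_nonneg, true_and]
      split_ifs with hp h1
      · rw [heightSum_succ, Fin.cons_zero, Fin.tail_cons, ha,
          Int.toNat_add (by omega) hp.heightSum_nonneg, Int.toNat_natCast, Finset.card_filter,
          Finset.card_filter, Fin.sum_univ_succ]
        simp only [Fin.cons_zero, Fin.cons_succ, h1, if_true]
        ring
      · rw [heightSum_succ, Fin.cons_zero, Fin.tail_cons, ha,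
          Int.toNat_add (by omega) hp.heightSum_nonneg, Int.toNat_natCast, Finset.card_filter,
          Finset.card_filter, Fin.sum_univ_succ]
        simp only [Fin.cons_zero, Fin.cons_succ, h1, if_false]
        ring
      · simp
      · simp
    rw [Finset.sum_filter, sum_fin_succ_eq_sum_cons, SignType.univ_eq, Finset.sum_insert (by decide),
      Finset.sum_insert (by decide), Finset.sum_singleton]
    rw [key 0 h (by simp), key 1 (h + 1) (by simp), pathSum]
    cases h with
    | zero =>
      -- A down step from height `0` would reach a negative height, so it starts no path.
      rw [Finset.sum_eq_zero fun w _ => if_neg ?_]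
      · simp
      · rintro ⟨_, hp⟩
        simpa using hp.nonneg
    | succ h =>
      rw [key (-1) h (by simp)]
      simp
      ring

/-- Up step `j` is recorded at `j` in `E` and down step `j` at `j + 1` in `T`, whence the argument
`v - 1`. The exclusions of `Fin.last m` and `0` ensure that every element records a step. Different
`g` give the final height, the partial heights and the height sum. -/
theorem sum_mul_step {m : ℕ} {w : Fin m → SignType} {E T : Finset (Fin (m + 1))}
    (hE : ∀ j, w j = 1 ↔ j.castSucc ∈ E) (hT : ∀ j, w j = -1 ↔ j.succ ∈ T)
    (hlast : Fin.last m ∉ E) (h0 : 0 ∉ T) (g : ℕ → ℤ) :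
    ∑ j : Fin m, g j * (w j : ℤ) = ∑ x ∈ E, g x - ∑ v ∈ T, g (v - 1) := by
  have e1 : ∑ x ∈ E, g x = ∑ j : Fin m, if w j = 1 then g j else 0 := by
    rw [← Finset.univ_inter E, ← Finset.sum_ite_mem, Fin.sum_univ_castSucc, if_neg hlast, add_zero]
    exact Finset.sum_congr rfl fun j _ => if_congr (hE j).symm rfl rfl
  have e2 : ∑ v ∈ T, g (v - 1) = ∑ j : Fin m, if w j = -1 then g j else 0 := by
    rw [← Finset.univ_inter T, ← Finset.sum_ite_mem, Fin.sum_univ_succ, if_neg h0, zero_add]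
    exact Finset.sum_congr rfl fun j _ => if_congr (hT j).symm rfl rfl
  rw [e1, e2, ← Finset.sum_sub_distrib]
  refine Finset.sum_congr rfl fun j _ => ?_
  cases w j <;> simp

theorem isPath_iff_ballot {m : ℕ} {w : Fin m → SignType} {E T : Finset (Fin (m + 1))}
    (hE : ∀ j, w j = 1 ↔ j.castSucc ∈ E) (hT : ∀ j, w j = -1 ↔ j.succ ∈ T)
    (hlast : Fin.last m ∉ E) (h0 : 0 ∉ T) :
    IsPath m 0 w ↔
      (∀ x, (T.filter fun v => v ≤ x).card ≤ (E.filter fun y => y < x).card) ∧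
        E.card = T.card := by
  have h1 : ∑ j, (w j : ℤ) = E.card - T.card := by
    simpa using sum_mul_step hE hT hlast h0 fun _ => 1
  have h2 : ∀ x : Fin (m + 1), (∑ j : Fin m, if (j : ℕ) < x then (w j : ℤ) else 0) =
      (E.filter fun y => y < x).card - (T.filter fun v => v ≤ x).card := by
    intro x
    have := sum_mul_step hE hT hlast h0 fun i => if i < x then 1 else 0
    simp only [ite_mul, one_mul, zero_mul, Finset.sum_boole] at this
    rw [this]
    congr 3
    refine Finset.filter_congr fun v hv => ?_
    have hv0 : (v : ℕ) ≠ 0 := fun h => h0 (by rwa [← show v = 0 from Fin.ext h])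
    rw [Fin.le_def]
    omega
  rw [isPath_iff, h1]
  refine and_congr ⟨fun h x => ?_, fun h i hi => ?_⟩ ?_
  · have := h x (by omega)
    rw [h2] at this
    omega
  · have := h ⟨i, by omega⟩
    rw [h2 ⟨i, by omega⟩]
    omega
  · omega

end Paths

/-! ### The bijection between 321-avoiders and Motzkin paths -/

section StepWord

variable {m : ℕ}

/-- The steps of the Motzkin path of `π`: up at an excedance position, down in front of an
excedance value. -/
def stepWord (π : Equiv.Perm (Fin (m + 1))) (j : Fin m) : SignType :=
  if j.castSucc < π j.castSucc then 1 else if π.symm j.succ < j.succ then -1 else 0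

/-- The `321`-avoiding permutations in which `i + 1` is a nonexcedance bottom whenever
`i < π(i)`. -/
def IsHat (π : Equiv.Perm (Fin (m + 1))) : Prop :=
  Avoids π ![3, 2, 1] ∧
    ∀ i v : Fin (m + 1), i < π i → (v : ℕ) = i + 1 → IsNonexcedanceBottom π v

variable {π : Equiv.Perm (Fin (m + 1))}

theorem stepWord_eq_one_iff (j : Fin m) :
    stepWord π j = 1 ↔ j.castSucc ∈ Finset.univ.filter fun x => x < π x := by
  rw [stepWord, Finset.mem_filter]
  split_ifs with h1 h2 <;> simp [h1]

theorem isNonexcedanceBottom_iff (v : Fin (m + 1)) :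
    IsNonexcedanceBottom π v ↔ ¬π.symm v < v := by
  rw [not_lt]
  constructor
  · rintro ⟨j, rfl, h⟩
    simpa using h
  · intro h
    exact ⟨π.symm v, by simp, by simpa using h⟩

/-- The definition gives precedence to up steps; the hat condition guarantees that no down step is
lost to it. -/
theorem IsHat.stepWord_eq_neg_one_iff (h : IsHat π) (j : Fin m) :
    stepWord π j = -1 ↔ j.succ ∈ Finset.univ.filter fun v => π.symm v < v := by
  rw [stepWord, Finset.mem_filter]
  split_ifs with h1 h2
  · have := (isNonexcedanceBottom_iff _).1 (h.2 _ j.succ h1 (by simp))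
    simp [this]
  · simp [h2]
  · simp [h2]

theorem last_notMem_excedances :
    Fin.last m ∉ Finset.univ.filter fun x => x < π x := by
  simp [Fin.le_last]

theorem zero_notMem_excedance_values :
    (0 : Fin (m + 1)) ∉ Finset.univ.filter fun v => π.symm v < v := by
  simp

theorem card_excedance_values :
    (Finset.univ.filter fun v => π.symm v < v).card = (Finset.univ.filter fun x => x < π x).card := by
  symm
  refine Finset.card_nbij π (fun x hx => ?_) π.injective.injOn fun v hv => ⟨π.symm v, ?_, by simp⟩
  · simpa using hx
  · simpa using hv

/-- Each excedance value `v ≤ x` comes from an excedance position below `v`, hence below `x`; this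
is the ballot inequality. -/
theorem IsHat.isPath (h : IsHat π) : IsPath m 0 (stepWord π) := by
  rw [isPath_iff_ballot stepWord_eq_one_iff h.stepWord_eq_neg_one_iff last_notMem_excedances
    zero_notMem_excedance_values]
  refine ⟨fun x => ?_, card_excedance_values.symm⟩
  refine Finset.card_le_card_of_injOn π.symm (fun v hv => ?_) π.symm.injective.injOn
  simp only [Finset.coe_filter, Finset.mem_filter, Finset.mem_univ, true_and,
    Set.mem_ofPred_eq, Equiv.apply_symm_apply] at hv ⊢
  exact ⟨hv.1, hv.1.trans_le hv.2⟩

theorem card_stepWord_eq_one : (Finset.univ.filter fun j => stepWord π j = 1).card = exc π := by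
  rw [exc, Finset.card_filter, Finset.card_filter, Fin.sum_univ_castSucc,
    if_neg (by simp [Fin.le_last]), add_zero]
  refine Finset.sum_congr rfl fun j _ => if_congr ?_ rfl rfl
  rw [stepWord_eq_one_iff]
  simp

/-- Pairing each excedance position `x` with its value, the up and down contributions combine to `(m
- x) - (m - (π x - 1)) = π x - x - 1`. -/
theorem IsHat.heightSum_stepWord (h : IsHat π) :
    (heightSum 0 (stepWord π)).toNat = inv π - exc π := by
  rw [inv_sub_exc h.1, heightSum, mul_zero, zero_add,
    sum_mul_step stepWord_eq_one_iff h.stepWord_eq_neg_one_iff last_notMem_excedances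
      zero_notMem_excedance_values fun i => (m : ℤ) - i]
  have e : ∑ v ∈ Finset.univ.filter (fun v => π.symm v < v), ((m : ℤ) - ((v : ℕ) - 1 : ℕ)) =
      ∑ x ∈ Finset.univ.filter (fun x => x < π x), ((m : ℤ) - ((π x : ℕ) - 1 : ℕ)) := by
    symm
    refine Finset.sum_nbij π (fun x hx => ?_) π.injective.injOn
      (fun v hv => ⟨π.symm v, ?_, by simp⟩) fun _ _ => rfl
    · simpa using hx
    · simpa using hv
  rw [e, ← Finset.sum_sub_distrib]
  rw [Finset.sum_congr rfl fun (x : Fin (m + 1)) hx => show (m : ℤ) - (x : ℕ) -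
    (m - ((π x : ℕ) - 1 : ℕ)) = (((π x : ℕ) - x - 1 : ℕ) : ℤ) by
      have : (x : ℕ) < π x := (Finset.mem_filter.1 hx).2
      omega]
  rw [← Nat.cast_sum, Int.toNat_natCast]

theorem IsHat.stepWord_injective {π' : Equiv.Perm (Fin (m + 1))} (h : IsHat π) (h' : IsHat π')
    (hw : stepWord π = stepWord π') : π = π' := by
  have hE : (Finset.univ.filter fun x => x < π x) = Finset.univ.filter fun x => x < π' x := by
    ext x
    refine Fin.lastCases ?_ (fun j => ?_) x
    · exact iff_of_false last_notMem_excedances last_notMem_excedances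
    · rw [← stepWord_eq_one_iff, ← stepWord_eq_one_iff, hw]
  have hT : (Finset.univ.filter fun v => π.symm v < v) =
      Finset.univ.filter fun v => π'.symm v < v := by
    ext v
    refine Fin.cases ?_ (fun j => ?_) v
    · exact iff_of_false zero_notMem_excedance_values zero_notMem_excedance_values
    · rw [← h.stepWord_eq_neg_one_iff, ← h'.stepWord_eq_neg_one_iff, hw]
  have m1 := strictMonoOn_excedances h.1
  have m2 := strictMonoOn_excedances h'.1
  have m3 := strictMonoOn_nonexcedances h.1
  have m4 := strictMonoOn_nonexcedances h'.1
  have hc := card_excedance_values (π := π)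
  have mem : ∀ (ρ : Equiv.Perm (Fin (m + 1))) x,
      ρ x ∈ (Finset.univ.filter fun v => ρ.symm v < v) ↔
        x ∈ Finset.univ.filter fun x => x < ρ x := fun ρ x => by simp
  have a := mem π
  have b := mem π'
  rw [← hE] at m2 m4 b
  rw [← hT] at b
  generalize (Finset.univ.filter fun x => x < π x) = E at *
  generalize (Finset.univ.filter fun v => π.symm v < v) = T at *
  ext x : 1
  by_cases hx : x ∈ E
  · exact eqOn_of_strictMonoOn m1 m2 (fun x hx => (a x).2 hx) (fun x hx => (b x).2 hx) hc hx
  · exact eqOn_of_strictMonoOn (T := Tᶜ) m3 m4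
      (fun x hx => Finset.mem_compl.2 (mt (a x).1 (Finset.mem_compl.1 hx)))
      (fun x hx => Finset.mem_compl.2 (mt (b x).1 (Finset.mem_compl.1 hx)))
      (by rw [Finset.card_compl, Finset.card_compl, hc]) (Finset.mem_compl.2 hx)

theorem IsPath.exists_isHat {w : Fin m → SignType} (hw : IsPath m 0 w) :
    ∃ π : Equiv.Perm (Fin (m + 1)), IsHat π ∧ stepWord π = w := by
  classical
  let E : Finset (Fin (m + 1)) := Finset.univ.filter fun x => ∃ j, w j = 1 ∧ j.castSucc = x
  let T : Finset (Fin (m + 1)) := Finset.univ.filter fun v => ∃ j, w j = -1 ∧ j.succ = v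
  have hE : ∀ j, w j = 1 ↔ j.castSucc ∈ E := fun j => by simp [E]
  have hT : ∀ j, w j = -1 ↔ j.succ ∈ T := fun j => by simp [T]
  have hlast : Fin.last m ∉ E := by simp [E, Fin.castSucc_ne_last]
  have h0 : 0 ∉ T := by simp [T, Fin.succ_ne_zero]
  obtain ⟨hb, hc⟩ := (isPath_iff_ballot hE hT hlast h0).1 hw
  obtain ⟨π, hπ, m1, m2⟩ := exists_perm_strictMonoOn E T hc
  have hexc := lt_apply_iff_of_ballot hπ m1 m2 hb
  have hval : ∀ v, π.symm v < v ↔ v ∈ T := fun v => by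
    have h1 := hexc (π.symm v)
    have h2 := hπ (π.symm v)
    rw [Equiv.apply_symm_apply] at h1 h2
    rw [h1, h2]
  refine ⟨π, ⟨avoids_321_of_strictMonoOn m1 m2, fun i v hi hv => ?_⟩, ?_⟩
  · have hv' : (v : ℕ) < m + 1 := v.isLt
    obtain ⟨j, rfl⟩ : ∃ j : Fin m, i = j.castSucc := ⟨⟨i, by omega⟩, rfl⟩
    obtain rfl : v = j.succ := Fin.ext (by simpa using hv)
    -- The hat condition holds because step `j`, being up, is not down.
    rw [isNonexcedanceBottom_iff, hval, ← hT, (hE j).2 ((hexc _).1 hi)]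
    decide
  · funext j
    rw [stepWord]
    simp only [hexc, hval, ← hE, ← hT]
    cases w j <;> decide

open Classical in
theorem coeff_pathSum_eq_sum_hatS321 (m k : ℕ) :
    (pathSum X (C X : ℤ[X][X]) m 0).coeff k = ∑ π ∈ hatS321 (m + 1) k, X ^ (inv π - exc π) := by
  have h1 : pathSum X (C X : ℤ[X][X]) m 0 =
      ∑ π ∈ Finset.univ.filter (fun π : Equiv.Perm (Fin (m + 1)) => IsHat π),
        X ^ exc π * C X ^ (inv π - exc π) := by
    rw [← sum_isPath, Nat.cast_zero]
    symm
    refine Finset.sum_nbij stepWord (fun π hπ => ?_) (fun π hπ π' hπ' h => ?_) (fun w hw => ?_)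
      fun π hπ => ?_
    · simp only [Finset.mem_filter, Finset.mem_univ, true_and] at hπ ⊢
      exact hπ.isPath
    · simp only [Finset.coe_filter, Finset.mem_univ, true_and, Set.mem_ofPred_eq] at hπ hπ'
      exact hπ.stepWord_injective hπ' h
    · simp only [Finset.coe_filter, Finset.mem_univ, true_and, Set.mem_ofPred_eq] at hw
      obtain ⟨π, hπ, rfl⟩ := hw.exists_isHat
      exact ⟨π, by simpa using hπ, rfl⟩
    · simp only [Finset.mem_filter, Finset.mem_univ, true_and] at hπ
      rw [card_stepWord_eq_one, hπ.heightSum_stepWord]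
  rw [h1, finsetSum_coeff, hatS321, Finset.sum_filter, Finset.sum_filter]
  refine Finset.sum_congr rfl fun π _ => ?_
  rw [← C_pow, coeff_mul_C, coeff_X_pow, ite_mul, one_mul, zero_mul, ← ite_and]
  exact if_congr (by rw [IsHat, eq_comm (a := k)]; tauto) rfl rfl

end StepWord

end QTCatalan

/-! ### Assembly of the theorem -/

open QTCatalan in
theorem theorem1p2 (n : ℕ) (hn : 1 ≤ n) :
    ∃ γ : ℕ → ℤ[X],
      qtCatalan n =
        ∑ k ∈ Finset.range ((n - 1) / 2 + 1), C (γ k) * X ^ k * (1 + X) ^ (n - 1 - 2 * k) ∧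
      ∀ k : ℕ,
        γ k = ∑ π ∈ hatS321 n k, X ^ (inv π - exc π) ∧
        γ k = ∑ π ∈ tildeS ![2, 1, 3] n k, X ^ vinc31_2 π ∧
        γ k = ∑ π ∈ tildeS ![3, 1, 2] n k, X ^ vinc2_13 π ∧
        γ k = ∑ π ∈ tildeStarS ![1, 3, 2] n k, X ^ vinc2_31 π ∧
        γ k = ∑ π ∈ tildeStarS ![2, 3, 1] n k, X ^ vinc13_2 π := by
  obtain ⟨m, rfl⟩ : ∃ m, n = m + 1 := ⟨n - 1, by omega⟩
  have h213 := isMotzkinSeq_avoidSum_213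
  have h312 := congrFun (isMotzkinSeq_avoidSum_312.unique h213) m
  have e1 : ∀ k, (avoidSum ![2, 1, 3] (fun _ => vinc31_2) (m + 1)).coeff k =
      ∑ π ∈ tildeS ![2, 1, 3] (m + 1) k, X ^ vinc31_2 π := coeff_avoidSum _ _ (m + 1)
  have e2 : ∀ k, (avoidSum ![2, 1, 3] (fun _ => vinc31_2) (m + 1)).coeff k =
      ∑ π ∈ tildeS ![3, 1, 2] (m + 1) k, X ^ vinc2_13 π := fun k => by
    rw [← coeff_avoidSum _ (fun _ => vinc2_13)]
    exact congrArg (fun p => coeff p k) h312.symm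
  refine ⟨fun k => (avoidSum ![2, 1, 3] (fun _ => vinc31_2) (m + 1)).coeff k,
    qtCatalan_eq_gamma_sum h213 m, fun k => ⟨?_, e1 k, e2 k, ?_, ?_⟩⟩
  · rw [← coeff_pathSum_eq_sum_hatS321, h213.pathSum_zero]
  · simp only [sum_tildeStarS_eq_sum_tildeS avoids_132_revCompl, vinc2_31_revCompl, e1]
  · simp only [sum_tildeStarS_eq_sum_tildeS avoids_231_revCompl, vinc13_2_revCompl, e2]
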